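/- Let $n\in\mathbb{N}$ with $n\ge 1$, let $d\in\mathbb{N}_0$, and let $s=(s_\alpha)_{\alpha\in\mathbb{N}_0^n}$ be a real sequence. Notation. A (non-negative Borel) measure $\mu$ on $\mathbb{R}^n$ represents $s$ if, for all $\alpha\in\mathbb{N}_0^n$, $x^\alpha$ is $\mu$-integrable and $s_\alpha=\int_{\mathbb{R}^n}x^\alpha\,\mathrm{d}\mu(x)$; $s$ is a determinate moment sequence if it has exactly one such representing measure. Let $L_s:\mathbb{R}[x_1,\dots,x_n]\to\mathbb{R}$ be the linear functional with $L_s(x^\alpha)=s_\alpha$. For $\beta\in\mathbb{N}_0^n$ the sequence $\partial^\beta s$ is given by $\partial^\beta s_\alpha:=(-1)^{|\beta|}L_s(\partial^\beta x^\alpha)$. Set $$f(z):=\sum_{\alpha\in\mathbb{N}_0^n}\frac{i^{|\alpha|}\,s_\alpha}{\alpha!}\,z^\alpha,\qquad f_\beta(z):=\sum_{\alpha\in\mathbb{N}_0^n}\frac{i^{|\alpha|}\,(\partial^\beta s_\alpha)}{\alpha!}\,z^\alpha .$$ Such a series is called entire if it converges (absolutely) for every $z\in\mathbb{C}^n$;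 membership in $L^2(\mathbb{R}^n,\mathbb{C})$ refers to its restriction to $\mathbb{R}^n$. For $h\in L^2(\mathbb{R}^n,\mathbb{C})$ let $\check h\in L^2(\mathbb{R}^n,\mathbb{C})$ be its unitary inverse Fourier transform, normalized as the inverse of the characteristic-function transform, i.e. the continuous extension to $L^2$ of $h\mapsto (2\pi)^{-n/2}\int_{\mathbb{R}^n}e^{-i\langle x,z\rangle}h(z)\,\mathrm{d}z$. Supports of $L^2$-functions are essential supports, and $\partial^\beta g\in L^2$ is meant for the distributional derivative. Then the following are equivalent: (i) $f$ is entire, and (a) $x^\beta f\in L^2(\mathbb{R}^n,\mathbb{C})$ for all $\beta\in\mathbb{N}_0^n$ with $|\beta|\le d$, (b) $g:=(2\pi)^{-n/2}\check f\ge 0$ almost everywhere on $\mathbb{R}^n$, (c) there is a constant $c\ge 0$ with $\operatorname{supp} g\subseteq[-c,c]^n$. (ii) $f$ is entire, and (a) $x^\beta f\in L^2(\mathbb{R}^n,\mathbb{C})$ for all $\beta\in\mathbb{N}_0^n$ with $|\beta|\le d$, (b) $g:=(2\pi)^{-n/2}\check f\ge 0$ almost everywhere on $\mathbb{R}^n$,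 (c) there is a constant $c\ge 0$ such that, for all $j=1,\dots,n$, the limit $\lim_{k\to\infty}\sqrt[2k]{s_{2k\cdot e_j}}$ exists and is at most $c$. (iii) For all $\beta\in\mathbb{N}_0^n$ with $|\beta|\le d$ the function $f_\beta$ is entire, and (a) $f_\beta\in L^2(\mathbb{R}^n,\mathbb{C})$ for all $\beta\in\mathbb{N}_0^n$ with $|\beta|\le d$, (b) $g:=(2\pi)^{-n/2}\check f_0\ge 0$ almost everywhere on $\mathbb{R}^n$, (c) there is a constant $c\ge 0$ with $\operatorname{supp} g\subseteq[-c,c]^n$. (iv) For all $\beta\in\mathbb{N}_0^n$ with $|\beta|\le d$ the function $f_\beta$ is entire, and (a) $f_\beta\in L^2(\mathbb{R}^n,\mathbb{C})$ for all $\beta\in\mathbb{N}_0^n$ with $|\beta|\le d$, (b) $g:=(2\pi)^{-n/2}\check f_0\ge 0$ almost everywhere on $\mathbb{R}^n$, (c) there is a constant $c\ge 0$ such that, for all $j=1,\dots,n$, the limit $\lim_{k\to\infty}\sqrt[2k]{s_{2k\cdot e_j}}$ exists and is at most $c$. (v) $s$ is a determinate moment sequence with an absolutely continuous representing measure $\mu$,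 $\mathrm{d}\mu(x)=g(x)\,\mathrm{d}x$, with a density $g\in L^2(\mathbb{R}^n,\mathbb{C})$ such that (a) $\partial^\beta g\in L^2(\mathbb{R}^n,\mathbb{C})$ for all $\beta\in\mathbb{N}_0^n$ with $|\beta|\le d$, (b) $g\ge 0$ almost everywhere on $\mathbb{R}^n$, (c) $\operatorname{supp} g\subseteq[-c,c]^n$ for some constant $c\ge 0$. -/

import Mathlib

open MeasureTheory Filter Topology FourierTransform
open scoped ContDiff ENNReal

noncomputable section

namespace MomentDensity

variable {n : ℕ}

/-- The monomial function `x ↦ x ^ α` on `ℝⁿ`. -/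
def monom (α : Fin n →₀ ℕ) (x : EuclideanSpace ℝ (Fin n)) : ℝ := ∏ j, x j ^ α j

/-! ### Moment sequences -/

/-- The measure `μ` represents `s`: all moments of `μ` exist and are given by `s`. -/
def Represents (μ : Measure (EuclideanSpace ℝ (Fin n))) (s : (Fin n →₀ ℕ) → ℝ) : Prop :=
  ∀ α, Integrable (monom α) μ ∧ ∫ x, monom α x ∂μ = s α

/-- `s` is a determinate moment sequence: it has exactly one (non-negative) representing
measure. -/
def IsDeterminate (s : (Fin n →₀ ℕ) → ℝ) : Prop :=
  ∃! μ : Measure (EuclideanSpace ℝ (Fin n)), Represents μ s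

/-- The Riesz functional `L_s : ℝ[x₁, …, xₙ] → ℝ`, the linear map with `L_s (x ^ α) = s α`. -/
def riesz (s : (Fin n →₀ ℕ) → ℝ) : MvPolynomial (Fin n) ℝ →ₗ[ℝ] ℝ :=
  (MvPolynomial.basisMonomials (Fin n) ℝ).constr ℝ s

/-- The operator `∂ ^ β = ∂₁ ^ β₁ ⋯ ∂ₙ ^ βₙ` on polynomials. -/
def polyDeriv (β : Fin n →₀ ℕ) (p : MvPolynomial (Fin n) ℝ) : MvPolynomial (Fin n) ℝ :=
  (List.finRange n).foldr (fun j q => (fun r => MvPolynomial.pderiv j r)^[β j] q) p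

/-- The sequence `∂ ^ β s`, that is, `(∂ ^ β s) α = (-1) ^ |β| L_s (∂ ^ β x ^ α)`. -/
def momentDeriv (β : Fin n →₀ ℕ) (s : (Fin n →₀ ℕ) → ℝ) (α : Fin n →₀ ℕ) : ℝ :=
  (-1) ^ β.degree * riesz s (polyDeriv β (MvPolynomial.monomial α 1))

/-! ### The characteristic power series -/

/-- The term `i ^ |α| s_α / α! z ^ α`, for `z ∈ ℂⁿ`. -/
def charTerm (s : (Fin n →₀ ℕ) → ℝ) (z : Fin n → ℂ) (α : Fin n →₀ ℕ) : ℂ :=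
  Complex.I ^ α.degree * (s α : ℂ) / (∏ j, ((α j).factorial : ℂ)) * ∏ j, z j ^ α j

/-- The power series `∑_α i ^ |α| s_α / α! z ^ α` is entire: it converges (unconditionally,
hence absolutely) at every point of `ℂⁿ`. -/
def IsEntireSeries (s : (Fin n →₀ ℕ) → ℝ) : Prop :=
  ∀ z : Fin n → ℂ, Summable (charTerm s z)

/-- The function `f(z) = ∑_α i ^ |α| s_α / α! z ^ α`, restricted to `z ∈ ℝⁿ`. -/
def charSeries (s : (Fin n →₀ ℕ) → ℝ) (x : EuclideanSpace ℝ (Fin n)) : ℂ :=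
  ∑' α, charTerm s (fun j => (x j : ℂ)) α

/-! ### The inverse Fourier transform on `L²` -/

/-- The unitary inverse of the transform `g ↦ (2π)^(-n/2) ∫ exp(i⟨x, z⟩) g(x) dx` on
`L²(ℝⁿ, ℂ)`, that is, the continuous extension of
`f ↦ (x ↦ (2π)^(-n/2) ∫ exp(-i⟨x, z⟩) f(z) dz)` from the Schwartz functions. It is obtained from
the `L²`-transform `𝓕` of Mathlib, which has the kernel `exp(-2πi⟨x, z⟩)`, by rescaling. -/
def invFourier (f : Lp ℂ 2 (volume : Measure (EuclideanSpace ℝ (Fin n))))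
    (x : EuclideanSpace ℝ (Fin n)) : ℂ :=
  (((2 * Real.pi) ^ (-(n : ℝ) / 2) : ℝ) : ℂ) *
    (𝓕 f : Lp ℂ 2 (volume : Measure (EuclideanSpace ℝ (Fin n)))) ((2 * Real.pi)⁻¹ • x)

/-- The function `g = (2π)^(-n/2) · f̌`, for `f ∈ L²(ℝⁿ, ℂ)`. -/
def density (f : EuclideanSpace ℝ (Fin n) → ℂ) (hf : MemLp f 2 volume)
    (x : EuclideanSpace ℝ (Fin n)) : ℂ :=
  (((2 * Real.pi) ^ (-(n : ℝ) / 2) : ℝ) : ℂ) * invFourier (hf.toLp f) x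

/-! ### Conditions on the density -/

/-- `g ≥ 0` almost everywhere (in particular `g` is real almost everywhere). -/
def NonnegAE (g : EuclideanSpace ℝ (Fin n) → ℂ) : Prop :=
  ∀ᵐ x, 0 ≤ (g x).re ∧ (g x).im = 0

/-- `supp g ⊆ [-c, c]ⁿ` for the (essential) support: `g = 0` almost everywhere off the cube. -/
def SuppInCube (c : ℝ) (g : EuclideanSpace ℝ (Fin n) → ℂ) : Prop :=
  ∀ᵐ x, (¬ ∀ j, x j ∈ Set.Icc (-c) c) → g x = 0

/-- `lim_{k → ∞} (s_{2k·e_j})^{1/(2k)}` exists and is at most `c`, for every `j`. -/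
def MomentGrowth (c : ℝ) (s : (Fin n →₀ ℕ) → ℝ) : Prop :=
  ∀ j, ∃ l ≤ c,
    Tendsto (fun k : ℕ => s (Finsupp.single j (2 * k)) ^ (1 / (2 * (k : ℝ)))) atTop (𝓝 l)

/-- The classical partial derivative `∂ ^ β = ∂₁ ^ β₁ ⋯ ∂ₙ ^ βₙ` of a smooth function. -/
def partialDeriv (β : Fin n →₀ ℕ) (φ : EuclideanSpace ℝ (Fin n) → ℂ) :
    EuclideanSpace ℝ (Fin n) → ℂ :=
  (List.finRange n).foldr
    (fun j ψ => (fun η x => lineDeriv ℝ η x (EuclideanSpace.single j 1))^[β j] ψ) φ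

/-- The distributional (weak) derivative `∂ ^ β g` of `g` belongs to `L²(ℝⁿ, ℂ)`. -/
def WeakDerivMemL2 (β : Fin n →₀ ℕ) (g : EuclideanSpace ℝ (Fin n) → ℂ) : Prop :=
  ∃ h : EuclideanSpace ℝ (Fin n) → ℂ, MemLp h 2 volume ∧
    ∀ φ : EuclideanSpace ℝ (Fin n) → ℂ, ContDiff ℝ ∞ φ → HasCompactSupport φ →
      ∫ x, g x * partialDeriv β φ x = (-1) ^ β.degree * ∫ x, h x * φ x

end MomentDensity

end

/-!
Up to the scaling `w ↦ 2πw`, `f` and `g` form a Fourier pair on `L²`. If `g ≥ 0`, then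
`g` is integrable: `∫ g(x) exp(-ε|x|²) dx` is the mean of the continuous function `f` against a
Gaussian that concentrates at `0`, so it stays bounded as `ε → 0` and Fatou's lemma applies. Hence
`f` is the characteristic function of the finite measure `dμ = g dx`. Restricted to a line it is a
convergent power series; the second symmetric differences of a characteristic function control the
second moment, and replacing the image measure `ν` by `x² dν` and iterating yields all moments. The
Taylor coefficients along all lines then identify the moments of `μ` with `s`.

The limit of `(∫ x_j^{2k} dμ)^{1/(2k)}` is the `μ`-essential supremum of `|x_j|`, so the growth
condition says exactly that `μ` lives on the cube. In particular every representing measure of `s`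
lives on the cube, where the exponential series may be integrated term by term: its characteristic
function is `f`, and `s` is determinate.

The Fourier transform exchanges `∂^β` with multiplication by a monomial. For a weak derivative of a
function supported in a cube this is seen by testing against truncated characters.
-/

noncomputable section

namespace MomentDensity

variable {n : ℕ}

theorem integrable_of_tendsto_of_integral_le {X : Type*} {mX : MeasurableSpace X} {μ : Measure X}
    {f : ℕ → X → ℝ} {g : X → ℝ} (hf : ∀ k, Integrable (f k) μ) (hf0 : ∀ k, 0 ≤ᵐ[μ] f k)
    (hfg : ∀ᵐ x ∂μ, Tendsto (fun k => f k x) atTop (𝓝 (g x))) {C : ℝ}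
    (hC : ∀ᶠ k in atTop, ∫ x, f k x ∂μ ≤ C) : Integrable g μ := by
  refine ⟨aestronglyMeasurable_of_tendsto_ae _ (fun k => (hf k).1) hfg, ?_⟩
  calc ∫⁻ x, ‖g x‖ₑ ∂μ
      = ∫⁻ x, liminf (fun k => ‖f k x‖ₑ) atTop ∂μ :=
        lintegral_congr_ae (hfg.mono fun x hx => hx.enorm.liminf_eq.symm)
    _ ≤ liminf (fun k => ∫⁻ x, ‖f k x‖ₑ ∂μ) atTop :=
        lintegral_liminf_le' fun k => (hf k).1.enorm
    _ ≤ ENNReal.ofReal C := by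
        refine liminf_le_of_frequently_le' (hC.mono fun k hk => ?_).frequently
        rw [← ofReal_integral_norm_eq_lintegral_enorm (hf k),
          integral_congr_ae ((hf0 k).mono fun x hx => Real.norm_of_nonneg hx)]
        exact ENNReal.ofReal_le_ofReal hk
    _ < ⊤ := ENNReal.ofReal_lt_top

section Fourier

variable {V : Type*} [NormedAddCommGroup V] [InnerProductSpace ℝ V] [FiniteDimensional ℝ V]
  [MeasurableSpace V] [BorelSpace V]

theorem continuous_fourier_of_integrable {u : V → ℂ} (hu : Integrable u) : Continuous (𝓕 u) :=
  VectorFourier.fourierIntegral_continuous (L := innerₗ V) Real.continuous_fourierChar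
    continuous_inner hu

theorem continuous_fourierInv_of_integrable {u : V → ℂ} (hu : Integrable u) :
    Continuous (𝓕⁻ u) := by
  rw [Real.fourierInv_eq_fourier_comp_neg]
  exact continuous_fourier_of_integrable hu.comp_neg

theorem integral_fourier_mul_eq {u v : V → ℂ} (hu : Integrable u) (hv : Integrable v) :
    ∫ x, 𝓕 u x * v x = ∫ x, u x * 𝓕 v x := by
  have h := VectorFourier.integral_fourierIntegral_smul_eq_flip (μ := volume) (ν := volume)
    (L := innerₗ V) Real.continuous_fourierChar continuous_inner hu hv
  rwa [flip_innerₗ] at h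

theorem integral_fourierInv_mul_eq {u v : V → ℂ} (hu : Integrable u) (hv : Integrable v) :
    ∫ x, 𝓕⁻ u x * v x = ∫ x, u x * 𝓕⁻ v x := by
  have h := VectorFourier.integral_fourierIntegral_smul_eq_flip (μ := volume) (ν := volume)
    (L := -innerₗ V) Real.continuous_fourierChar continuous_inner.neg hu hv
  rwa [show (-innerₗ V).flip = -innerₗ V from congrArg Neg.neg (flip_innerₗ V)] at h

theorem fourier_comp_smul (u : V → ℂ) {c : ℝ} (hc : 0 < c) (w : V) :
    𝓕 (fun x => u (c • x)) w = ((c ^ Module.finrank ℝ V)⁻¹ : ℝ) • 𝓕 u (c⁻¹ • w) := by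
  have h := Measure.integral_comp_smul_of_nonneg (volume : Measure V)
    (fun v => Real.fourierChar (-(inner ℝ v (c⁻¹ • w))) • u v) c (hR := hc.le)
  simpa only [Real.fourier_eq, real_inner_smul_left, real_inner_smul_right,
    inv_mul_cancel_left₀ hc.ne'] using h

theorem memLp_comp_smul {u : V → ℂ} {p : ℝ≥0∞} (hu : MemLp u p) {c : ℝ} (hc : c ≠ 0) :
    MemLp (fun x => u (c • x)) p := by
  refine MemLp.comp_of_map (g := u) ?_ (measurable_const_smul c).aemeasurable
  rw [Measure.map_addHaar_smul _ hc]
  exact hu.smul_measure ENNReal.ofReal_ne_top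

theorem ae_eq_of_integral_mul_schwartz_eq {f g : V → ℂ} (hf : LocallyIntegrable f)
    (hg : LocallyIntegrable g)
    (h : ∀ φ : SchwartzMap V ℂ, HasCompactSupport φ → ∫ x, f x * φ x = ∫ x, g x * φ x) :
    f =ᵐ[volume] g := by
  refine ae_eq_of_integral_contDiff_smul_eq hf hg fun χ hχ hc => ?_
  have hc' : HasCompactSupport (Complex.ofRealCLM ∘ χ) := hc.comp_left rfl
  have hχ' : ContDiff ℝ ∞ (Complex.ofRealCLM ∘ χ) := by fun_prop
  simpa [mul_comm] using h (hc'.toSchwartzMap hχ') hc'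

/-- `F` is square integrable and `g` is a representative of its `L²` Fourier transform, in
Mathlib's normalization with the kernel `exp(-2πi⟨x, w⟩)`. -/
def IsFourierL2 (F g : V → ℂ) : Prop :=
  ∃ hF : MemLp F 2, (𝓕 (hF.toLp F) : Lp ℂ 2 (volume : Measure V)) =ᵐ[volume] g

namespace IsFourierL2

variable {F F' g g' : V → ℂ}

theorem memLp_left (h : IsFourierL2 F g) : MemLp F 2 := h.1

theorem memLp_right (h : IsFourierL2 F g) : MemLp g 2 :=
  (memLp_congr_ae h.2).1 (Lp.memLp _)

theorem right_unique (h : IsFourierL2 F g) (h' : IsFourierL2 F g') : g =ᵐ[volume] g' :=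
  h.2.symm.trans h'.2

theorem left_unique (h : IsFourierL2 F g) (h' : IsFourierL2 F' g) : F =ᵐ[volume] F' := by
  have hL : h.1.toLp F = h'.1.toLp F' :=
    (Lp.fourierTransformₗᵢ V ℂ).injective (Lp.ext (h.2.trans h'.2.symm))
  exact h.1.coeFn_toLp.symm.trans (hL ▸ h'.1.coeFn_toLp)

theorem integral_mul_schwartz (h : IsFourierL2 F g) (φ : SchwartzMap V ℂ) :
    ∫ x, g x * φ x = ∫ x, F x * 𝓕 (φ : V → ℂ) x := by
  obtain ⟨hF, hg⟩ := h
  have key := congrArg (fun T => T φ) (Lp.fourier_toTemperedDistribution_eq (hF.toLp F))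
  simp only [TemperedDistribution.fourier_apply, Lp.toTemperedDistribution_apply, smul_eq_mul,
    SchwartzMap.fourier_coe] at key
  calc ∫ x, g x * φ x = ∫ x, φ x * (𝓕 (hF.toLp F) : Lp ℂ 2 (volume : Measure V)) x :=
        integral_congr_ae (by filter_upwards [hg] with x hx using by rw [hx, mul_comm])
    _ = ∫ x, 𝓕 (φ : V → ℂ) x * hF.toLp F x := key.symm
    _ = ∫ x, F x * 𝓕 (φ : V → ℂ) x :=
        integral_congr_ae (by filter_upwards [hF.coeFn_toLp] with x hx using by rw [hx, mul_comm])

theorem of_forall_integral_mul_schwartz (hF : MemLp F 2) (hg : LocallyIntegrable g)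
    (h : ∀ φ : SchwartzMap V ℂ, HasCompactSupport φ →
      ∫ x, g x * φ x = ∫ x, F x * 𝓕 (φ : V → ℂ) x) : IsFourierL2 F g := by
  have hF' : IsFourierL2 F (𝓕 (hF.toLp F) : Lp ℂ 2 (volume : Measure V)) := ⟨hF, ae_eq_rfl⟩
  refine ⟨hF, ae_eq_of_integral_mul_schwartz_eq
    (hF'.memLp_right.locallyIntegrable one_le_two) hg fun φ hφ => ?_⟩
  rw [hF'.integral_mul_schwartz, h φ hφ]

theorem fourier {u : V → ℂ} (h1 : Integrable u) (h2 : MemLp u 2) : IsFourierL2 u (𝓕 u) :=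
  of_forall_integral_mul_schwartz h2 (continuous_fourier_of_integrable h1).locallyIntegrable
    fun φ _ => integral_fourier_mul_eq h1 φ.integrable

theorem fourierInv {u : V → ℂ} (h1 : Integrable u) (h2 : MemLp u 2) : IsFourierL2 (𝓕⁻ u) u := by
  have h2' : MemLp (𝓕⁻ u) 2 := by
    rw [Real.fourierInv_eq_fourier_comp_neg]
    exact (fourier h1.comp_neg
      (h2.comp_measurePreserving (Measure.measurePreserving_neg volume))).memLp_right
  refine of_forall_integral_mul_schwartz h2' (h2.locallyIntegrable one_le_two) fun φ _ => ?_
  rw [← SchwartzMap.fourier_coe, integral_fourierInv_mul_eq h1 (𝓕 φ).integrable,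
    ← SchwartzMap.fourierInv_coe, FourierPair.fourierInv_fourier_eq]

theorem comp_smul (h : IsFourierL2 F g) {c : ℝ} (hc : 0 < c) :
    IsFourierL2 (fun x => F (c • x))
      (fun w => ((c ^ Module.finrank ℝ V)⁻¹ : ℝ) • g (c⁻¹ • w)) := by
  have hg := (memLp_comp_smul h.memLp_right (inv_ne_zero hc.ne')).const_smul
    (c ^ Module.finrank ℝ V)⁻¹
  refine of_forall_integral_mul_schwartz (memLp_comp_smul h.memLp_left hc.ne')
    (hg.locallyIntegrable one_le_two) fun φ hφ => ?_
  have hφc : HasCompactSupport fun x => φ (c • x) :=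
    hφ.comp_homeomorph (Homeomorph.smulOfNeZero c hc.ne')
  have hφs : ContDiff ℝ ∞ fun x => φ (c • x) := (φ.smooth ⊤).comp (contDiff_const_smul c)
  have hleft := Measure.integral_comp_smul_of_nonneg (volume : Measure V)
    (fun x => g x * φ (c • x)) c⁻¹ (hR := inv_nonneg.2 hc.le)
  have hright := Measure.integral_comp_smul_of_nonneg (volume : Measure V)
    (fun x => F x * 𝓕 (φ : V → ℂ) (c⁻¹ • x)) c (hR := hc.le)
  simp only [smul_inv_smul₀ hc.ne'] at hleft
  simp only [inv_smul_smul₀ hc.ne'] at hright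
  calc ∫ x, ((c ^ Module.finrank ℝ V)⁻¹ : ℝ) • g (c⁻¹ • x) * φ x
      = ∫ x, g x * φ (c • x) := by
        simp only [smul_mul_assoc]
        rw [integral_smul, hleft, smul_smul, inv_pow, inv_inv,
          inv_mul_cancel₀ (pow_ne_zero _ hc.ne'), one_smul]
    _ = ∫ x, F x * 𝓕 (fun x => φ (c • x)) x :=
        h.integral_mul_schwartz (hφc.toSchwartzMap hφs)
    _ = ∫ x, F (c • x) * 𝓕 (φ : V → ℂ) x := by
        simp only [fourier_comp_smul _ hc, mul_smul_comm]
        rw [integral_smul, hright]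

theorem integral_mul_eq {G : V → ℂ} (h : IsFourierL2 F g) (h' : IsFourierL2 G g') :
    ∫ x, g x * G x = ∫ x, F x * g' x := by
  let B : Lp ℂ 2 (volume : Measure V) →L[ℂ] Lp ℂ 2 (volume : Measure V) →L[ℂ] ℂ :=
    (ContinuousLinearMap.mul ℂ ℂ).lpPairing volume 2 2
  have hB {U W : Lp ℂ 2 (volume : Measure V)} {u w : V → ℂ} (hu : U =ᵐ[volume] u)
      (hw : W =ᵐ[volume] w) : B U W = ∫ x, u x * w x := by
    refine (ContinuousLinearMap.lpPairing_eq_integral _ U W).trans (integral_congr_ae ?_)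
    filter_upwards [hu, hw] with x hx hx'
    rw [hx, hx', ContinuousLinearMap.mul_apply']
  suffices key : ∀ W, B (𝓕 (h.1.toLp F)) W = B (h.1.toLp F) (𝓕 W) by
    rw [← hB h.2 h'.1.coeFn_toLp, ← hB h.1.coeFn_toLp h'.2, key]
  refine fun W => DenseRange.induction_on
    (SchwartzMap.denseRange_toLpCLM (F := ℂ) (E := V) (p := 2) ENNReal.ofNat_ne_top) W ?_ ?_
  · exact isClosed_eq (B _).continuous
      ((B _).continuous.comp (Lp.fourierTransformₗᵢ V ℂ).continuous)
  · intro φ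
    rw [SchwartzMap.toLpCLM_apply, SchwartzMap.toLp_fourier_eq, hB h.2 (φ.coeFn_toLp 2 volume),
      hB h.1.coeFn_toLp ((𝓕 φ).coeFn_toLp 2 volume), h.integral_mul_schwartz,
      SchwartzMap.fourier_coe]

theorem eq_fourierInv (h : IsFourierL2 F g) (hF : Continuous F) (hg : Integrable g) :
    F = 𝓕⁻ g :=
  (hF.ae_eq_iff_eq volume (continuous_fourierInv_of_integrable hg)).1
    (h.left_unique (fourierInv hg h.memLp_right))

end IsFourierL2

/-! ### Integrability of nonnegative transforms -/

theorem integrable_cexp_neg_mul_sq_norm {b : ℂ} (hb : 0 < b.re) :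
    Integrable fun x : V => Complex.exp (-b * ‖x‖ ^ 2) := by
  simpa using GaussianFourier.integrable_cexp_neg_mul_sq_norm_add (V := V) hb 0 0

theorem memLp_two_cexp_neg_mul_sq_norm {b : ℂ} (hb : 0 < b.re) :
    MemLp (fun x : V => Complex.exp (-b * ‖x‖ ^ 2)) 2 := by
  rw [memLp_two_iff_integrable_sq_norm (integrable_cexp_neg_mul_sq_norm hb).1]
  refine (integrable_cexp_neg_mul_sq_norm (V := V) (b := 2 * b) (by simpa using hb)).norm.congr
    (ae_of_all _ fun x => ?_)
  beta_reduce
  rw [← norm_pow, ← Complex.exp_nat_mul]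
  congr 2
  push_cast
  ring

theorem tendsto_cpow_add_one_div_self (a : ℂ) :
    Tendsto (fun c : ℝ => (((c + 1) / c : ℝ) : ℂ) ^ a) atTop (𝓝 1) := by
  have h : Tendsto (fun c : ℝ => (c + 1) / c) atTop (𝓝 1) := by
    have h' := (tendsto_inv_atTop_zero (𝕜 := ℝ)).const_add 1
    rw [add_zero] at h'
    refine h'.congr' ((eventually_ne_atTop 0).mono fun c hc => ?_)
    field_simp
  simpa using (h.ofReal).cpow tendsto_const_nhds (by simp)

theorem fourier_gaussian_eq_peak_mul_gaussian {c : ℝ} (hc : 0 < c) (x : V) :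
    𝓕 (fun y : V => Complex.exp (-((c + 1)⁻¹ : ℝ) * ‖y‖ ^ 2)) x =
      (((c + 1) / c : ℝ) : ℂ) ^ (Module.finrank ℝ V / 2 : ℂ) *
        (((Real.pi * c : ℂ) ^ (Module.finrank ℝ V / 2 : ℂ) *
          Complex.exp (-Real.pi ^ 2 * c * ‖0 - x‖ ^ 2)) *
            Complex.exp (-(Real.pi ^ 2 : ℝ) * ‖x‖ ^ 2)) := by
  have hb : 0 < (((c + 1)⁻¹ : ℝ) : ℂ).re := by
    rw [Complex.ofReal_re]
    positivity
  have hbase : (Real.pi / ((c + 1)⁻¹ : ℝ) : ℂ) = ((c + 1) / c : ℝ) * (Real.pi * c : ℝ) := by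
    have : (c : ℂ) ≠ 0 := Complex.ofReal_ne_zero.2 hc.ne'
    push_cast
    field_simp
  rw [fourier_gaussian_innerProductSpace hb, hbase,
    Complex.mul_cpow_ofReal_nonneg (by positivity) (by positivity), mul_assoc, mul_assoc,
    ← Complex.exp_add, Complex.ofReal_mul, zero_sub, norm_neg]
  congr 4
  push_cast
  rw [div_inv_eq_mul]
  ring

-- The peaks concentrate at the origin, while the fixed Gaussian factor makes `F` integrable.
theorem IsFourierL2.tendsto_integral_mul_gaussian {F g : V → ℂ} (h : IsFourierL2 F g)
    (hF : ContinuousAt F 0) :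
    Tendsto (fun c : ℝ => ∫ x, g x * Complex.exp (-((c + 1)⁻¹ : ℝ) * ‖x‖ ^ 2)) atTop
      (𝓝 (F 0)) := by
  set G : V → ℂ := fun x => Complex.exp (-(Real.pi ^ 2 : ℝ) * ‖x‖ ^ 2)
  have hG : MemLp G 2 := by
    refine memLp_two_cexp_neg_mul_sq_norm ?_
    rw [Complex.ofReal_re]
    positivity
  have hGF : Integrable fun x => G x * F x := hG.integrable_mul h.memLp_left
  have hGc : ContinuousAt (fun x => G x * F x) 0 := ContinuousAt.mul (by fun_prop) hF
  have hG0 : G 0 * F 0 = F 0 := by simp [G]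
  have hpeak := (tendsto_cpow_add_one_div_self (Module.finrank ℝ V / 2 : ℂ)).mul
    (Real.tendsto_integral_gaussian_smul' hGF hGc)
  rw [one_mul, hG0] at hpeak
  refine hpeak.congr' ((eventually_gt_atTop 0).mono fun c hc => ?_)
  have hb : 0 < (((c + 1)⁻¹ : ℝ) : ℂ).re := by
    rw [Complex.ofReal_re]
    positivity
  beta_reduce
  rw [h.integral_mul_eq (.fourier (integrable_cexp_neg_mul_sq_norm hb)
    (memLp_two_cexp_neg_mul_sq_norm hb)), ← integral_const_mul]
  refine integral_congr_ae (ae_of_all _ fun x => ?_)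
  simp only [fourier_gaussian_eq_peak_mul_gaussian hc, smul_eq_mul, G]
  ring

theorem IsFourierL2.integrable_of_nonneg {F g : V → ℂ} (h : IsFourierL2 F g)
    (hF : ContinuousAt F 0) (hg : ∀ᵐ x, 0 ≤ (g x).re ∧ (g x).im = 0) : Integrable g := by
  set γ : ℕ → V → ℝ := fun k x => Real.exp (-((k : ℝ) + 1)⁻¹ * ‖x‖ ^ 2)
  have hγ (k : ℕ) (x : V) : Complex.exp (-(((k : ℝ) + 1)⁻¹ : ℝ) * ‖x‖ ^ 2) = (γ k x : ℂ) := by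
    simp [γ]
  have hre : g =ᵐ[volume] fun x => ((g x).re : ℂ) := hg.mono fun x hx => Complex.ext rfl hx.2
  have hint (k : ℕ) : Integrable fun x => g x * γ k x := by
    simp only [← hγ]
    refine h.memLp_right.integrable_mul (memLp_two_cexp_neg_mul_sq_norm ?_)
    rw [Complex.ofReal_re]
    positivity
  have hlim : Tendsto (fun k => ∫ x, (g x).re * γ k x) atTop (𝓝 (F 0).re) := by
    have h' := Complex.continuous_re.continuousAt.tendsto.comp
      ((h.tendsto_integral_mul_gaussian hF).comp tendsto_natCast_atTop_atTop)
    refine h'.congr fun k => ?_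
    simp only [Function.comp_apply, hγ, ← Complex.re_mul_ofReal]
    exact (integral_re (hint k)).symm
  have hpt (x : V) : Tendsto (fun k => (g x).re * γ k x) atTop (𝓝 (g x).re) := by
    have h0 := (tendsto_one_div_add_atTop_nhds_zero_nat (𝕜 := ℝ)).neg.mul_const (‖x‖ ^ 2)
    simpa [γ] using ((Real.continuous_exp.tendsto _).comp h0).const_mul (g x).re
  refine Integrable.congr (Integrable.ofReal ?_) hre.symm
  refine integrable_of_tendsto_of_integral_le (f := fun k x => (g x).re * γ k x)
    (fun k => (hint k).re.congr (ae_of_all _ fun x => Complex.re_mul_ofReal _ _))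
    (fun k => hg.mono fun x hx => mul_nonneg hx.1 (Real.exp_pos _).le) (ae_of_all _ hpt)
    (hlim.eventually_le_const (lt_add_one _))

end Fourier

/-! ### The density as a Fourier transform -/

theorem isFourierL2_density {f : EuclideanSpace ℝ (Fin n) → ℂ} (hf : MemLp f 2) :
    IsFourierL2 (fun x => f ((2 * Real.pi) • x)) (density f hf) := by
  have hf' : IsFourierL2 f (𝓕 (hf.toLp f) : Lp ℂ 2 (volume : Measure _)) := ⟨hf, ae_eq_rfl⟩
  convert hf'.comp_smul Real.two_pi_pos using 1
  ext x
  rw [density, invFourier, ← mul_assoc, ← Complex.ofReal_mul, ← Real.rpow_add Real.two_pi_pos,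
    ← add_div, ← two_mul, mul_div_cancel_left₀ _ two_ne_zero, Real.rpow_neg Real.two_pi_pos.le,
    Real.rpow_natCast, finrank_euclideanSpace_fin, Complex.real_smul]

/-! ### The sequence `∂ ^ β s` -/

theorem iterate_pderiv_monomial {R : Type*} [CommSemiring R] (j : Fin n) (k : ℕ) (α : Fin n →₀ ℕ)
    (a : R) :
    (fun r => MvPolynomial.pderiv j r)^[k] (MvPolynomial.monomial α a) =
      MvPolynomial.monomial (α - Finsupp.single j k) (a * ((α j).descFactorial k : R)) := by
  induction k with
  | zero => simp
  | succ k ih =>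
    rw [Function.iterate_succ_apply', ih, MvPolynomial.pderiv_monomial, tsub_tsub,
      ← Finsupp.single_add, Finsupp.tsub_apply, Finsupp.single_eq_same, Nat.descFactorial_succ,
      mul_comm (α j - k), Nat.cast_mul, mul_assoc]

theorem foldr_pderiv_monomial (β α : Fin n →₀ ℕ) {l : List (Fin n)} (hl : l.Nodup) :
    l.foldr (fun j q => (fun r => MvPolynomial.pderiv j r)^[β j] q)
        (MvPolynomial.monomial α (1 : ℝ)) =
      MvPolynomial.monomial (α - ∑ j ∈ l.toFinset, Finsupp.single j (β j))
        (∏ j ∈ l.toFinset, ((α j).descFactorial (β j) : ℝ)) := by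
  induction l with
  | nil => simp
  | cons j l ih =>
    have hj : j ∉ l.toFinset := by simpa using (List.nodup_cons.1 hl).1
    have h0 : (∑ i ∈ l.toFinset, Finsupp.single i (β i)) j = 0 := by
      rw [Finsupp.finsetSum_apply]
      refine Finset.sum_eq_zero fun i hi => Finsupp.single_eq_of_ne ?_
      rintro rfl
      exact hj hi
    rw [List.foldr_cons, ih (List.nodup_cons.1 hl).2, iterate_pderiv_monomial,
      List.toFinset_cons, Finset.sum_insert hj, Finset.prod_insert hj, tsub_tsub,
      Finsupp.tsub_apply, h0, tsub_zero, mul_comm, add_comm]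

theorem polyDeriv_monomial (β α : Fin n →₀ ℕ) :
    polyDeriv β (MvPolynomial.monomial α 1) =
      MvPolynomial.monomial (α - β) (∏ j, ((α j).descFactorial (β j) : ℝ)) := by
  rw [polyDeriv, foldr_pderiv_monomial _ _ (List.nodup_finRange n), List.toFinset_finRange,
    Finsupp.univ_sum_single]

theorem riesz_monomial (s : (Fin n →₀ ℕ) → ℝ) (α : Fin n →₀ ℕ) (a : ℝ) :
    riesz s (MvPolynomial.monomial α a) = a * s α := by
  have h : MvPolynomial.monomial α a = a • MvPolynomial.basisMonomials (Fin n) ℝ α := by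
    simp [MvPolynomial.smul_monomial]
  rw [h, map_smul, riesz, Module.Basis.constr_basis, smul_eq_mul]

theorem momentDeriv_apply (β : Fin n →₀ ℕ) (s : (Fin n →₀ ℕ) → ℝ) (α : Fin n →₀ ℕ) :
    momentDeriv β s α =
      (-1) ^ β.degree * ((∏ j, ((α j).descFactorial (β j) : ℝ)) * s (α - β)) := by
  rw [momentDeriv, polyDeriv_monomial, riesz_monomial]

theorem momentDeriv_zero (s : (Fin n →₀ ℕ) → ℝ) : momentDeriv 0 s = s := by
  ext α
  simp [momentDeriv_apply]

/-! ### Multiplication of the power series by monomials -/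

theorem charTerm_momentDeriv_add (β : Fin n →₀ ℕ) (s : (Fin n →₀ ℕ) → ℝ) (z : Fin n → ℂ)
    (α : Fin n →₀ ℕ) :
    charTerm (momentDeriv β s) z (α + β) =
      (-Complex.I) ^ β.degree * (∏ j, z j ^ β j) * charTerm s z α := by
  have hfac : (∏ j, (((α + β) j).factorial : ℂ)) =
      (∏ j, ((α j).factorial : ℂ)) * ∏ j, (((α + β) j).descFactorial (β j) : ℂ) := by
    rw [← Finset.prod_mul_distrib]
    refine Finset.prod_congr rfl fun j _ => ?_
    rw [← Nat.factorial_mul_descFactorial (n := (α + β) j) (k := β j) (by simp)]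
    simp
  have hpow : ∏ j, z j ^ (α + β) j = (∏ j, z j ^ α j) * ∏ j, z j ^ β j := by
    rw [← Finset.prod_mul_distrib]
    exact Finset.prod_congr rfl fun j _ => by rw [Finsupp.add_apply, pow_add]
  have hfac_ne : (∏ j, ((α j).factorial : ℂ)) ≠ 0 :=
    Finset.prod_ne_zero_iff.2 fun j _ => Nat.cast_ne_zero.2 (Nat.factorial_ne_zero _)
  have hdesc_ne : (∏ j, ((α j + β j).descFactorial (β j) : ℂ)) ≠ 0 :=
    Finset.prod_ne_zero_iff.2 fun j _ => Nat.cast_ne_zero.2 (by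
      rw [Ne, Nat.descFactorial_eq_zero_iff_lt]
      simp)
  rw [charTerm, charTerm, momentDeriv_apply, hfac, add_tsub_cancel_right, hpow,
    map_add Finsupp.degree, pow_add, neg_pow Complex.I]
  simp only [Finsupp.add_apply]
  push_cast
  field_simp

theorem charTerm_momentDeriv_eq_zero {β α : Fin n →₀ ℕ} (h : ¬ β ≤ α) (s : (Fin n →₀ ℕ) → ℝ)
    (z : Fin n → ℂ) : charTerm (momentDeriv β s) z α = 0 := by
  obtain ⟨j, hj⟩ : ∃ j, α j < β j := by simpa only [Finsupp.le_def, not_forall, not_le] using h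
  have h0 : ∏ j, ((α j).descFactorial (β j) : ℝ) = 0 :=
    Finset.prod_eq_zero (Finset.mem_univ j) (by
      rw [Nat.descFactorial_eq_zero_iff_lt.2 hj, Nat.cast_zero])
  simp [charTerm, momentDeriv_apply, h0]

theorem hasSum_charTerm_momentDeriv (β : Fin n →₀ ℕ) {s : (Fin n →₀ ℕ) → ℝ} {z : Fin n → ℂ}
    {a : ℂ} (h : HasSum (charTerm s z) a) :
    HasSum (charTerm (momentDeriv β s) z) ((-Complex.I) ^ β.degree * (∏ j, z j ^ β j) * a) := by
  refine ((add_left_injective β).hasSum_iff fun α hα => ?_).1 ?_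
  · exact charTerm_momentDeriv_eq_zero (fun hle => hα ⟨α - β, tsub_add_cancel_of_le hle⟩) s z
  · simpa only [Function.comp_def, charTerm_momentDeriv_add] using h.mul_left _

theorem IsEntireSeries.momentDeriv {s : (Fin n →₀ ℕ) → ℝ} (h : IsEntireSeries s)
    (β : Fin n →₀ ℕ) : IsEntireSeries (momentDeriv β s) :=
  fun z => (hasSum_charTerm_momentDeriv β (h z).hasSum).summable

theorem charSeries_momentDeriv {s : (Fin n →₀ ℕ) → ℝ} (h : IsEntireSeries s)
    (β : Fin n →₀ ℕ) (x : EuclideanSpace ℝ (Fin n)) :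
    charSeries (momentDeriv β s) x =
      (-Complex.I) ^ β.degree * ((monom β x : ℂ) * charSeries s x) := by
  rw [charSeries, (hasSum_charTerm_momentDeriv β (h _).hasSum).tsum_eq, mul_assoc, monom]
  push_cast
  rfl

theorem memLp_charSeries_momentDeriv_iff {s : (Fin n →₀ ℕ) → ℝ} (h : IsEntireSeries s)
    (β : Fin n →₀ ℕ) {p : ℝ≥0∞} {μ : Measure (EuclideanSpace ℝ (Fin n))} :
    MemLp (charSeries (momentDeriv β s)) p μ ↔
      MemLp (fun x => (monom β x : ℂ) * charSeries s x) p μ := by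
  rw [funext (charSeries_momentDeriv h β)]
  have hne : (-Complex.I) ^ β.degree ≠ 0 := pow_ne_zero _ (neg_ne_zero.2 Complex.I_ne_zero)
  refine ⟨fun hm => ?_, fun hm => hm.const_mul _⟩
  simpa only [inv_mul_cancel_left₀ hne] using hm.const_mul ((-Complex.I) ^ β.degree)⁻¹

theorem norm_charTerm (s : (Fin n →₀ ℕ) → ℝ) (z : Fin n → ℂ) (α : Fin n →₀ ℕ) :
    ‖charTerm s z α‖ = |s α| / (∏ j, ((α j).factorial : ℝ)) * ∏ j, ‖z j‖ ^ α j := by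
  simp [charTerm]

theorem continuous_charSeries {s : (Fin n →₀ ℕ) → ℝ} (h : IsEntireSeries s) :
    Continuous (charSeries s) := by
  refine continuous_iff_continuousAt.2 fun x => ?_
  set R := ‖x‖ + 1
  suffices hc : ContinuousOn (charSeries s) (Metric.ball 0 R) from
    hc.continuousAt (Metric.isOpen_ball.mem_nhds (by simp [R]))
  refine continuousOn_tsum (u := fun α => ‖charTerm s (fun _ => (R : ℂ)) α‖)
    (fun α => ?_) (h _).norm fun α y hy => ?_
  · unfold charTerm
    fun_prop
  · rw [norm_charTerm, norm_charTerm]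
    gcongr with j
    rw [Complex.norm_real, Complex.norm_real, Real.norm_of_nonneg (r := R) (by positivity)]
    exact (PiLp.norm_apply_le y j).trans (mem_ball_zero_iff.1 hy).le

/-! ### Grouping multi-indices by degree -/

/-- The multi-indices `α ∈ ℕⁿ` of degree `k`, indexing the homogeneous part of degree `k` of a
power series in `n` variables. -/
def multiIndices (n k : ℕ) : Finset (Fin n →₀ ℕ) := Finset.univ.finsuppAntidiag k

theorem mem_multiIndices {k : ℕ} {α : Fin n →₀ ℕ} : α ∈ multiIndices n k ↔ α.degree = k := by
  simp [multiIndices, Finsupp.degree_eq_sum]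

theorem sum_mul_pow_eq {K : Type*} [Field K] [CharZero K] (x v : Fin n → K) (k : ℕ) :
    (∑ j, x j * v j) ^ k = ∑ α ∈ multiIndices n k,
      (k.factorial : K) / (∏ j, ((α j).factorial : K)) * ((∏ j, x j ^ α j) * ∏ j, v j ^ α j) := by
  rw [Finset.sum_pow_eq_sum_piAntidiag]
  refine Finset.sum_bij' (fun a _ => Finsupp.equivFunOnFinite.symm a) (fun α _ => ⇑α)
    (fun a ha => ?_) (fun α hα => ?_) (fun a _ => rfl) (fun α _ => by simp) (fun a ha => ?_)
  · simpa [mem_multiIndices, Finsupp.degree_eq_sum] using ha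
  · simpa [mem_multiIndices, Finsupp.degree_eq_sum] using hα
  · have hmult := Nat.multinomial_spec (Finset.univ : Finset (Fin n)) a
    rw [(Finset.mem_piAntidiag.1 ha).1] at hmult
    have hne : (∏ j, ((a j).factorial : K)) ≠ 0 :=
      Finset.prod_ne_zero_iff.2 fun j _ => Nat.cast_ne_zero.2 (Nat.factorial_ne_zero _)
    simp only [Finsupp.equivFunOnFinite_symm_apply_apply]
    rw [← hmult, ← Finset.prod_mul_distrib, Nat.cast_mul, Nat.cast_prod,
      mul_div_cancel_left₀ _ hne]
    simp only [mul_pow]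

/-- The decomposition of the multi-indices by their degree, for summing over them degree by
degree. -/
def sigmaMultiIndicesEquiv (n : ℕ) : (Σ k, multiIndices n k) ≃ (Fin n →₀ ℕ) where
  toFun p := p.2
  invFun α := ⟨α.degree, α, mem_multiIndices.2 rfl⟩
  left_inv := by
    rintro ⟨k, α, hα⟩
    obtain rfl := mem_multiIndices.1 hα
    rfl
  right_inv _ := rfl

theorem hasSum_sum_multiIndices {E : Type*} [AddCommMonoid E] [TopologicalSpace E]
    [ContinuousAdd E] [RegularSpace E] {f : (Fin n →₀ ℕ) → E} {a : E} (h : HasSum f a) :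
    HasSum (fun k => ∑ α ∈ multiIndices n k, f α) a :=
  HasSum.sigma ((sigmaMultiIndicesEquiv n).hasSum_iff.2 h)
    fun k => (multiIndices n k).hasSum f

theorem summable_of_summable_sum_multiIndices {f : (Fin n →₀ ℕ) → ℝ} (hf : ∀ α, 0 ≤ f α)
    (h : Summable fun k => ∑ α ∈ multiIndices n k, f α) : Summable f := by
  refine (sigmaMultiIndicesEquiv n).summable_iff.1 ((summable_sigma_of_nonneg fun p => hf _).2
    ⟨fun k => (Set.toFinite _).summable _, h.congr fun k => ?_⟩)
  exact ((multiIndices n k).tsum_subtype f).symm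

/-! ### Moments of measures on the line -/

theorem tendsto_symmetric_second_difference {E : Type*} [NormedAddCommGroup E] [NormedSpace ℝ E]
    {G : ℝ → E} (hG : ContDiff ℝ 2 G) :
    Tendsto (fun t => (t ^ 2)⁻¹ • (G t + G (-t) - (2 : ℝ) • G 0)) (𝓝[≠] 0)
      (𝓝 (iteratedDeriv 2 G 0)) := by
  have hT := taylor_tendsto convex_univ (Set.mem_univ (0 : ℝ)) hG.contDiffOn
  rw [nhdsWithin_univ] at hT
  have hneg : Tendsto (fun t : ℝ => -t) (𝓝 0) (𝓝 0) := by
    simpa using (continuous_neg (G := ℝ)).tendsto 0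
  have hsum := ((hT.add (hT.comp hneg)).const_add (iteratedDeriv 2 G 0)).mono_left
    (nhdsWithin_le_nhds (s := {0}ᶜ))
  simp only [add_zero] at hsum
  refine hsum.congr' (eventually_mem_nhdsWithin.mono fun t ht => ?_)
  have ht0 : t ≠ 0 := ht
  simp only [Function.comp_apply, taylor_within_apply, Finset.sum_range_succ,
    iteratedDerivWithin_univ, Finset.range_zero, Finset.sum_empty, iteratedDeriv_zero, sub_zero,
    Nat.factorial, Nat.cast_one, pow_zero, zero_add]
  match_scalars <;> field_simp <;> norm_num

theorem sq_mul_sinc_half_eq {t : ℝ} (ht : t ≠ 0) (x : ℝ) :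
    (x * Real.sinc (t * x / 2)) ^ 2 = (t ^ 2)⁻¹ * (2 * (1 - Real.cos (t * x))) := by
  rcases eq_or_ne x 0 with rfl | hx
  · simp
  rw [Real.sinc_of_ne_zero (by positivity), ← mul_div_cancel₀ (t * x) (two_ne_zero (α := ℝ)),
    mul_div_cancel_left₀ _ two_ne_zero, Real.cos_two_mul, Real.cos_sq']
  field_simp
  ring

section LineMoments

variable {ν : Measure ℝ} [IsFiniteMeasure ν]

theorem re_charFun_eq_integral_cos (t : ℝ) : (charFun ν t).re = ∫ x, Real.cos (t * x) ∂ν := by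
  have hint : Integrable (fun x : ℝ => Complex.exp (t * x * Complex.I)) ν :=
    (integrable_const (1 : ℝ)).mono' (by fun_prop) (ae_of_all _ fun x => by
      rw [← Complex.ofReal_mul, Complex.norm_exp_ofReal_mul_I])
  rw [charFun_apply_real]
  refine (integral_re hint).symm.trans (integral_congr_ae (ae_of_all _ fun x => ?_))
  beta_reduce
  rw [← Complex.ofReal_mul]
  exact Complex.exp_ofReal_mul_I_re _

theorem integral_sq_mul_sinc_half_eq {t : ℝ} (ht : t ≠ 0) :
    ∫ x, (x * Real.sinc (t * x / 2)) ^ 2 ∂ν =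
      -((t ^ 2)⁻¹ • (charFun ν t + charFun ν (-t) - (2 : ℝ) • charFun ν 0)).re := by
  have hcos : Integrable (fun x => Real.cos (t * x)) ν :=
    (integrable_const (1 : ℝ)).mono' (by fun_prop) (ae_of_all _ fun x => by
      simpa using Real.abs_cos_le_one _)
  simp only [sq_mul_sinc_half_eq ht, Complex.smul_re, Complex.sub_re, Complex.add_re,
    re_charFun_eq_integral_cos, neg_mul, Real.cos_neg, zero_mul, Real.cos_zero, smul_eq_mul]
  rw [integral_const_mul, integral_const_mul, integral_sub (integrable_const 1) hcos]
  ring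

theorem integrable_sq_of_contDiff_charFun (h : ContDiff ℝ 2 (charFun ν)) :
    Integrable (fun x => x ^ 2) ν := by
  set c : ℕ → ℝ := fun k => 1 / ((k : ℝ) + 1)
  have hc0 (k : ℕ) : c k ≠ 0 := by positivity
  have hc : Tendsto c atTop (𝓝 0) := tendsto_one_div_add_atTop_nhds_zero_nat
  have hlim : Tendsto (fun k => ∫ x, (x * Real.sinc (c k * x / 2)) ^ 2 ∂ν) atTop
      (𝓝 (-(iteratedDeriv 2 (charFun ν) 0).re)) := by
    simp only [integral_sq_mul_sinc_half_eq (hc0 _)]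
    exact ((Complex.continuous_re.tendsto _).comp ((tendsto_symmetric_second_difference h).comp
      (tendsto_nhdsWithin_iff.2 ⟨hc, .of_forall hc0⟩))).neg
  have hpt (x : ℝ) : Tendsto (fun k => (x * Real.sinc (c k * x / 2)) ^ 2) atTop (𝓝 (x ^ 2)) := by
    have harg : Tendsto (fun k => c k * x / 2) atTop (𝓝 0) := by
      simpa using (hc.mul_const x).div_const 2
    simpa using (((Real.continuous_sinc.tendsto 0).comp harg).const_mul x).pow 2
  have hint (k : ℕ) : Integrable (fun x => (x * Real.sinc (c k * x / 2)) ^ 2) ν := by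
    simp only [sq_mul_sinc_half_eq (hc0 _)]
    refine (((integrable_const 1).sub ?_).const_mul 2).const_mul _
    exact (integrable_const (1 : ℝ)).mono' (by fun_prop) (ae_of_all _ fun x => by
      simpa using Real.abs_cos_le_one _)
  exact integrable_of_tendsto_of_integral_le hint (fun k => ae_of_all _ fun x => sq_nonneg _)
    (ae_of_all _ hpt) (hlim.eventually_le_const (lt_add_one _))

theorem charFun_withDensity_sq (h : Integrable (fun x => x ^ 2) ν) (t : ℝ) :
    charFun (ν.withDensity fun x => ((x ^ 2).toNNReal : ℝ≥0∞)) t =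
      -iteratedDeriv 2 (charFun ν) t := by
  have hid : MemLp id (2 : ℕ) ν := by
    rwa [Nat.cast_ofNat, memLp_two_iff_integrable_sq (by fun_prop)]
  rw [iteratedDeriv_charFun hid, charFun_apply_real,
    integral_withDensity_eq_integral_smul (by fun_prop), Complex.I_sq, neg_one_mul, neg_neg]
  refine integral_congr_ae (ae_of_all _ fun x => ?_)
  simp [NNReal.smul_def, Real.coe_toNNReal _ (sq_nonneg x)]

-- Tilting by `x ^ 2` turns `-(charFun ν)''` into a characteristic function: two moments per step.
theorem integrable_pow_of_contDiff_charFun {k : ℕ}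
    (h : ContDiff ℝ (2 * k : ℕ) (charFun ν)) : Integrable (fun x => x ^ (2 * k)) ν := by
  induction k generalizing ν with
  | zero => simp
  | succ k ih =>
    have hsq := integrable_sq_of_contDiff_charFun (h.of_le (by
      exact_mod_cast (show 2 ≤ 2 * (k + 1) by lia)))
    have : IsFiniteMeasure (ν.withDensity fun x => ((x ^ 2).toNNReal : ℝ≥0∞)) :=
      isFiniteMeasure_withDensity_ofReal hsq.hasFiniteIntegral
    have htilt := ih (ν := ν.withDensity fun x => ((x ^ 2).toNNReal : ℝ≥0∞)) (by
      rw [funext (charFun_withDensity_sq hsq), iteratedDeriv_eq_iterate]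
      exact (ContDiff.iterate_deriv' (2 * k) 2 h).neg)
    rw [integrable_withDensity_iff_integrable_smul (by fun_prop)] at htilt
    refine htilt.congr (ae_of_all _ fun x => ?_)
    simp only [NNReal.smul_def, Real.coe_toNNReal _ (sq_nonneg x), smul_eq_mul]
    ring

theorem memLp_id_of_contDiff_charFun (h : ContDiff ℝ ∞ (charFun ν)) (k : ℕ) : MemLp id k ν := by
  rcases Nat.eq_zero_or_pos k with rfl | hk
  · simpa using aestronglyMeasurable_id
  suffices hid : MemLp id (2 * k : ℕ) ν from
    hid.mono_exponent (by exact_mod_cast (by lia : k ≤ 2 * k))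
  refine (integrable_norm_rpow_iff (by fun_prop) (by simpa using hk.ne')
    (ENNReal.natCast_ne_top _)).1 ?_
  rw [ENNReal.toReal_natCast]
  refine (integrable_pow_of_contDiff_charFun (k := k) (contDiff_infty.1 h _)).congr
    (ae_of_all _ fun x => ?_)
  simp only [Real.rpow_natCast, id, Real.norm_eq_abs, pow_mul, sq_abs]

theorem hasFPowerSeriesOnBall_of_hasSum_pow {F : ℝ → ℂ} {c : ℕ → ℂ}
    (h : ∀ t : ℝ, HasSum (fun k => c k * (t : ℂ) ^ k) (F t)) :
    HasFPowerSeriesOnBall F (fun k => ContinuousMultilinearMap.mkPiRing ℝ (Fin k) (c k)) 0 ⊤ where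
  r_le := by
    refine (FormalMultilinearSeries.radius_eq_top_of_summable_norm _ fun r => ?_).ge
    refine (h r).summable.norm.congr fun k => ?_
    simp [ContinuousMultilinearMap.norm_mkPiRing]
  r_pos := ENNReal.zero_lt_top
  hasSum {t} _ := by
    rw [zero_add]
    refine (h t).congr_fun fun k => ?_
    simp [mul_comm]

theorem memLp_id_of_hasSum_charFun {c : ℕ → ℂ}
    (h : ∀ t : ℝ, HasSum (fun k => c k * (t : ℂ) ^ k) (charFun ν t)) (k : ℕ) :
    MemLp id k ν := by
  have hanalytic : AnalyticOnNhd ℝ (charFun ν) Set.univ := by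
    simpa using (hasFPowerSeriesOnBall_of_hasSum_pow h).analyticOnNhd
  exact memLp_id_of_contDiff_charFun (contDiffOn_univ.1 (hanalytic.contDiffOn uniqueDiffOn_univ)) k

theorem factorial_mul_coeff_charFun {c : ℕ → ℂ}
    (h : ∀ t : ℝ, HasSum (fun k => c k * (t : ℂ) ^ k) (charFun ν t)) (k : ℕ) :
    (k.factorial : ℂ) * c k = Complex.I ^ k * ((∫ x, x ^ k ∂ν : ℝ) : ℂ) := by
  have hcoeff := (hasFPowerSeriesOnBall_of_hasSum_pow h).factorial_smul 1 k
  rw [← iteratedDeriv_eq_iteratedFDeriv,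
    iteratedDeriv_charFun_zero (memLp_id_of_hasSum_charFun h k)] at hcoeff
  rw [← hcoeff]
  simp

end LineMoments

/-! ### Moments of measures on `ℝⁿ` -/

theorem continuous_monom (α : Fin n →₀ ℕ) : Continuous (monom α) := by
  unfold monom
  fun_prop

theorem abs_monom_le_pow {c : ℝ} {x : EuclideanSpace ℝ (Fin n)} (hx : ∀ j, |x j| ≤ c)
    (α : Fin n →₀ ℕ) : |monom α x| ≤ c ^ α.degree := by
  rw [monom, Finset.abs_prod, Finsupp.degree_eq_sum, ← Finset.prod_pow_eq_pow_sum]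
  refine Finset.prod_le_prod (fun j _ => abs_nonneg _) fun j _ => ?_
  rw [abs_pow]
  exact pow_le_pow_left₀ (abs_nonneg _) (hx j) _

theorem abs_monom_le (α : Fin n →₀ ℕ) (x : EuclideanSpace ℝ (Fin n)) :
    |monom α x| ≤ 1 + ∑ j, x j ^ (2 * α.degree) := by
  rcases isEmpty_or_nonempty (Fin n) with hn | hn
  · simp [monom]
  obtain ⟨i, hi⟩ := Finite.exists_max fun j => |x j|
  calc |monom α x| ≤ |x i| ^ α.degree := abs_monom_le_pow hi α
    _ ≤ 1 + x i ^ (2 * α.degree) := by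
        rw [mul_comm, pow_mul, ← sq_abs, abs_pow]
        nlinarith [sq_nonneg (|x i| ^ α.degree - 1)]
    _ ≤ 1 + ∑ j, x j ^ (2 * α.degree) := by
        gcongr
        exact Finset.single_le_sum (f := fun j => x j ^ (2 * α.degree))
          (fun j _ => (even_two_mul _).pow_nonneg _) (Finset.mem_univ i)

theorem charFun_map_sum_mul (μ : Measure (EuclideanSpace ℝ (Fin n)))
    (v : EuclideanSpace ℝ (Fin n)) (t : ℝ) :
    charFun (μ.map fun x => ∑ j, x j * v j) t = charFun μ (t • v) := by
  rw [charFun_apply_real, charFun_apply, integral_map (by fun_prop) (by fun_prop)]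
  refine integral_congr_ae (ae_of_all _ fun x => ?_)
  beta_reduce
  rw [inner_smul_right, ← Complex.ofReal_mul, PiLp.inner_apply]
  simp only [RCLike.inner_apply, conj_trivial, mul_comm]

theorem charTerm_smul (s : (Fin n →₀ ℕ) → ℝ) (z : Fin n → ℂ) (t : ℂ) (α : Fin n →₀ ℕ) :
    charTerm s (fun j => t * z j) α = charTerm s z α * t ^ α.degree := by
  simp only [charTerm, mul_pow, Finset.prod_mul_distrib, Finsupp.degree_eq_sum,
    Finset.prod_pow_eq_pow_sum]
  ring

theorem eq_of_sum_multiIndices_eq {R : Type*} [CommRing R] [IsDomain R] [Infinite R] {k : ℕ}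
    {a b : (Fin n →₀ ℕ) → R}
    (h : ∀ v : Fin n → R, ∑ β ∈ multiIndices n k, a β * ∏ j, v j ^ β j =
      ∑ β ∈ multiIndices n k, b β * ∏ j, v j ^ β j) {α : Fin n →₀ ℕ}
    (hα : α ∈ multiIndices n k) : a α = b α := by
  have hpoly : ∑ β ∈ multiIndices n k, MvPolynomial.monomial β (a β) =
      ∑ β ∈ multiIndices n k, MvPolynomial.monomial β (b β) :=
    MvPolynomial.funext fun v => by
      simpa [MvPolynomial.eval_monomial, Finsupp.prod_fintype] using h v
  simpa [MvPolynomial.coeff_sum, MvPolynomial.coeff_monomial, hα] using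
    congrArg (MvPolynomial.coeff α) hpoly

theorem hasSum_charSeries_smul {s : (Fin n →₀ ℕ) → ℝ} (hs : IsEntireSeries s)
    (v : EuclideanSpace ℝ (Fin n)) (t : ℝ) :
    HasSum (fun k => (∑ α ∈ multiIndices n k, charTerm s (fun j => v j) α) * (t : ℂ) ^ k)
      (charSeries s (t • v)) := by
  refine (hasSum_sum_multiIndices (hs fun j => (((t • v) j : ℝ) : ℂ)).hasSum).congr_fun
    fun k => ?_
  rw [Finset.sum_mul]
  refine Finset.sum_congr rfl fun α hα => ?_
  rw [← mem_multiIndices.1 hα, ← charTerm_smul]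
  simp

theorem sum_charTerm_multiIndices_eq (s : (Fin n →₀ ℕ) → ℝ) (v : Fin n → ℝ) (k : ℕ) :
    ∑ α ∈ multiIndices n k, charTerm s (fun j => (v j : ℂ)) α = Complex.I ^ k *
      ((∑ α ∈ multiIndices n k, s α / (∏ j, ((α j).factorial : ℝ)) * ∏ j, v j ^ α j : ℝ) : ℂ) := by
  push_cast
  rw [Finset.mul_sum]
  refine Finset.sum_congr rfl fun α hα => ?_
  rw [charTerm, mem_multiIndices.1 hα]
  ring

theorem integral_sum_mul_pow_eq {μ : Measure (EuclideanSpace ℝ (Fin n))}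
    (hμ : ∀ α, Integrable (monom α) μ) (v : Fin n → ℝ) (k : ℕ) :
    ∫ x, (∑ j, x j * v j) ^ k ∂μ = k.factorial * ∑ α ∈ multiIndices n k,
      (∫ x, monom α x ∂μ) / (∏ j, ((α j).factorial : ℝ)) * ∏ j, v j ^ α j := by
  have hterm (α : Fin n →₀ ℕ) : Integrable (fun x => (k.factorial : ℝ) /
      (∏ j, ((α j).factorial : ℝ)) * (monom α x * ∏ j, v j ^ α j)) μ :=
    ((hμ α).mul_const _).const_mul _
  simp only [sum_mul_pow_eq]
  refine (integral_finsetSum _ fun α _ => hterm α).trans ?_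
  rw [Finset.mul_sum]
  refine Finset.sum_congr rfl fun α _ => ?_
  rw [integral_const_mul, integral_mul_const]
  ring

theorem hasSum_charFun_map_sum_mul {μ : Measure (EuclideanSpace ℝ (Fin n))}
    {s : (Fin n →₀ ℕ) → ℝ} (hs : IsEntireSeries s) (h : ∀ z, charFun μ z = charSeries s z)
    (v : EuclideanSpace ℝ (Fin n)) (t : ℝ) :
    HasSum (fun k => (∑ α ∈ multiIndices n k, charTerm s (fun j => v j) α) * (t : ℂ) ^ k)
      (charFun (μ.map fun x => ∑ j, x j * v j) t) := by
  rw [charFun_map_sum_mul, h]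
  exact hasSum_charSeries_smul hs v t

section CharFunEqCharSeries

variable {μ : Measure (EuclideanSpace ℝ (Fin n))} [IsFiniteMeasure μ] {s : (Fin n →₀ ℕ) → ℝ}

theorem integrable_monom_of_charFun_eq (hs : IsEntireSeries s)
    (h : ∀ z, charFun μ z = charSeries s z) (α : Fin n →₀ ℕ) : Integrable (monom α) μ := by
  have hcoord (j : Fin n) (k : ℕ) :
      Integrable (fun x : EuclideanSpace ℝ (Fin n) => x j ^ k) μ := by
    have hid := memLp_id_of_hasSum_charFun
      (hasSum_charFun_map_sum_mul hs h (EuclideanSpace.single j 1)) k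
    have hpow : Integrable (fun x => x ^ k) (μ.map fun x => x j) := by
      refine MemLp.integrable_norm_pow' (f := id) ?_ |>.mono' (by fun_prop)
        (ae_of_all _ fun x => (norm_pow x k).le)
      simpa using hid
    exact hpow.comp_measurable (by fun_prop)
  refine ((integrable_const (1 : ℝ)).add
    (integrable_finsetSum Finset.univ fun j _ => hcoord j (2 * α.degree))).mono'
    (continuous_monom α).aestronglyMeasurable (ae_of_all _ fun x => ?_)
  simpa using abs_monom_le α x

-- Comparing coefficients along every line determines the homogeneous parts, hence each moment.
theorem represents_of_charFun_eq (hs : IsEntireSeries s) (h : ∀ z, charFun μ z = charSeries s z) :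
    Represents μ s := by
  have hint := integrable_monom_of_charFun_eq hs h
  refine fun α => ⟨hint α, ?_⟩
  have hfac : ∏ j, ((α j).factorial : ℝ) ≠ 0 :=
    Finset.prod_ne_zero_iff.2 fun j _ => Nat.cast_ne_zero.2 (Nat.factorial_ne_zero _)
  refine (div_left_inj' hfac).1 (eq_of_sum_multiIndices_eq
    (a := fun α => (∫ x, monom α x ∂μ) / ∏ j, ((α j).factorial : ℝ))
    (b := fun α => s α / ∏ j, ((α j).factorial : ℝ)) (fun v => ?_)
    (mem_multiIndices.2 (rfl : α.degree = _)))
  have hline := factorial_mul_coeff_charFun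
    (hasSum_charFun_map_sum_mul hs h (WithLp.toLp 2 v)) α.degree
  rw [integral_map (by fun_prop) (by fun_prop), integral_sum_mul_pow_eq hint,
    sum_charTerm_multiIndices_eq, mul_left_comm, Complex.ofReal_mul,
    Complex.ofReal_natCast] at hline
  exact (Complex.ofReal_injective (mul_left_cancel₀ (Nat.cast_ne_zero.2 α.degree.factorial_ne_zero)
    (mul_left_cancel₀ (pow_ne_zero _ Complex.I_ne_zero) hline))).symm

end CharFunEqCharSeries

/-! ### Growth of the even moments -/

section EvenMoments

theorem tendsto_mul_rpow_one_div {δ : ℝ} (hδ : 0 < δ) (a : ℝ) :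
    Tendsto (fun k : ℕ => a * δ ^ (1 / (2 * (k : ℝ)))) atTop (𝓝 a) := by
  have hexp : Tendsto (fun k : ℕ => 1 / (2 * (k : ℝ))) atTop (𝓝 0) := by
    simpa using (tendsto_inv_atTop_nhds_zero_nat (𝕜 := ℝ)).mul_const (2⁻¹ : ℝ)
  simpa using
    ((Real.continuousAt_const_rpow (b := 0) hδ.ne').tendsto.comp hexp).const_mul a

theorem pow_mul_rpow_one_div {a δ : ℝ} (ha : 0 ≤ a) (hδ : 0 ≤ δ) {k : ℕ} (hk : k ≠ 0) :
    (a ^ (2 * k) * δ) ^ (1 / (2 * (k : ℝ))) = a * δ ^ (1 / (2 * (k : ℝ))) := by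
  have hroot : 1 / (2 * (k : ℝ)) = ((2 * k : ℕ) : ℝ)⁻¹ := by push_cast; exact one_div _
  rw [Real.mul_rpow (by positivity) hδ, hroot, Real.pow_rpow_inv_natCast ha (by positivity)]

variable {Ω : Type*} [MeasurableSpace Ω] {μ : Measure Ω} [IsFiniteMeasure μ] {y : Ω → ℝ}

theorem eventually_lt_rpow_moment (hint : ∀ k, Integrable (fun x => y x ^ (2 * k)) μ)
    {a a' : ℝ} (ha : 0 ≤ a) (hμ : μ {x | a < |y x|} ≠ 0) (haa : a' < a) :
    ∀ᶠ k : ℕ in atTop, a' < (∫ x, y x ^ (2 * k) ∂μ) ^ (1 / (2 * (k : ℝ))) := by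
  set δ := μ.real {x | a < |y x|}
  have hδ : 0 < δ := ENNReal.toReal_pos hμ (measure_ne_top _ _)
  have hmarkov (k : ℕ) : a ^ (2 * k) * δ ≤ ∫ x, y x ^ (2 * k) ∂μ := by
    refine le_trans (mul_le_mul_of_nonneg_left (measureReal_mono fun x hx => ?_) (by positivity))
      (mul_meas_ge_le_integral_of_nonneg
        (ae_of_all _ fun x => (even_two_mul k).pow_nonneg (y x)) (hint k) (a ^ (2 * k)))
    rw [Set.mem_ofPred_eq, ← (even_two_mul k).pow_abs (y x)]
    exact pow_le_pow_left₀ ha (le_of_lt hx) _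
  filter_upwards [(tendsto_mul_rpow_one_div hδ a).eventually_const_lt haa, eventually_ne_atTop 0]
    with k hk hk0
  refine hk.trans_le ?_
  rw [← pow_mul_rpow_one_div ha hδ.le hk0]
  exact Real.rpow_le_rpow (by positivity) (hmarkov k) (by positivity)

theorem eventually_rpow_moment_lt (hint : ∀ k, Integrable (fun x => y x ^ (2 * k)) μ)
    {b b' : ℝ} (hb : 0 ≤ b) (hμ : ∀ᵐ x ∂μ, |y x| ≤ b) (hbb : b < b') :
    ∀ᶠ k : ℕ in atTop, (∫ x, y x ^ (2 * k) ∂μ) ^ (1 / (2 * (k : ℝ))) < b' := by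
  set C := μ.real Set.univ + 1
  have hC : 0 < C := by positivity
  have hle (k : ℕ) : ∫ x, y x ^ (2 * k) ∂μ ≤ b ^ (2 * k) * C := by
    calc ∫ x, y x ^ (2 * k) ∂μ ≤ ∫ _, b ^ (2 * k) ∂μ := by
          refine integral_mono_ae (hint k) (integrable_const _) ?_
          filter_upwards [hμ] with x hx
          rw [← (even_two_mul k).pow_abs (y x)]
          exact pow_le_pow_left₀ (abs_nonneg _) hx _
      _ ≤ b ^ (2 * k) * C := by
          rw [integral_const, smul_eq_mul, mul_comm]
          exact mul_le_mul_of_nonneg_left (by simp [C]) (by positivity)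
  filter_upwards [(tendsto_mul_rpow_one_div hC b).eventually_lt_const hbb, eventually_ne_atTop 0]
    with k hk hk0
  refine lt_of_le_of_lt ?_ hk
  rw [← pow_mul_rpow_one_div hb hC.le hk0]
  exact Real.rpow_le_rpow (integral_nonneg fun x => (even_two_mul k).pow_nonneg (y x)) (hle k)
    (by positivity)

-- The limit is the essential supremum of `|y|`.
theorem exists_tendsto_rpow_moment (hint : ∀ k, Integrable (fun x => y x ^ (2 * k)) μ) {c : ℝ}
    (hc : 0 ≤ c) (hμ : ∀ᵐ x ∂μ, |y x| ≤ c) :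
    ∃ l ≤ c, Tendsto (fun k : ℕ => (∫ x, y x ^ (2 * k) ∂μ) ^ (1 / (2 * (k : ℝ)))) atTop
      (𝓝 l) := by
  set S := {b : ℝ | 0 ≤ b ∧ ∀ᵐ x ∂μ, |y x| ≤ b}
  have hS : BddBelow S := ⟨0, fun b hb => hb.1⟩
  have hcS : c ∈ S := ⟨hc, hμ⟩
  refine ⟨sInf S, csInf_le hS hcS, tendsto_order.2 ⟨fun a' ha' => ?_, fun b' hb' => ?_⟩⟩
  · rcases lt_or_ge a' 0 with h0 | h0
    · exact .of_forall fun k => h0.trans_le (Real.rpow_nonneg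
        (integral_nonneg fun x => (even_two_mul k).pow_nonneg (y x)) _)
    · obtain ⟨a, haa, haS⟩ := exists_between ha'
      refine eventually_lt_rpow_moment hint (h0.trans haa.le) (fun h => ?_) haa
      refine haS.not_ge (csInf_le hS ⟨h0.trans haa.le, ?_⟩)
      rw [ae_iff]
      simpa using h
  · obtain ⟨b, hbS, hb⟩ := exists_lt_of_csInf_lt ⟨c, hcS⟩ hb'
    exact eventually_rpow_moment_lt hint hbS.1 hbS.2 hb

theorem ae_abs_le_of_tendsto_rpow_moment (hint : ∀ k, Integrable (fun x => y x ^ (2 * k)) μ)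
    {c l : ℝ} (hc : 0 ≤ c) (hl : l ≤ c)
    (h : Tendsto (fun k : ℕ => (∫ x, y x ^ (2 * k) ∂μ) ^ (1 / (2 * (k : ℝ)))) atTop (𝓝 l)) :
    ∀ᵐ x ∂μ, |y x| ≤ c := by
  have hle (m : ℕ) : ∀ᵐ x ∂μ, |y x| ≤ c + 1 / ((m : ℝ) + 1) := by
    rw [ae_iff]
    by_contra hne
    simp only [not_le] at hne
    obtain ⟨a, hca, ha⟩ := exists_between (lt_add_of_pos_right c (Nat.one_div_pos_of_nat (n := m)))
    obtain ⟨k, hk, hk'⟩ := ((eventually_lt_rpow_moment hint (by positivity) hne ha).and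
      (h.eventually_lt_const (hl.trans_lt hca))).exists
    exact lt_asymm hk hk'
  filter_upwards [ae_all_iff.2 hle] with x hx
  have hlim := (tendsto_one_div_add_atTop_nhds_zero_nat (𝕜 := ℝ)).const_add c
  exact ge_of_tendsto (by simpa using hlim) (.of_forall hx)

end EvenMoments

theorem monom_single (j : Fin n) (k : ℕ) (x : EuclideanSpace ℝ (Fin n)) :
    monom (Finsupp.single j k) x = x j ^ k := by
  rw [monom, Finset.prod_eq_single j (fun i _ hi => by simp [Finsupp.single_eq_of_ne hi])
    (by simp), Finsupp.single_eq_same]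

section Represents

variable {μ : Measure (EuclideanSpace ℝ (Fin n))} {s : (Fin n →₀ ℕ) → ℝ} {c : ℝ}

theorem Represents.isFiniteMeasure (h : Represents μ s) : IsFiniteMeasure μ := by
  have hone : monom (0 : Fin n →₀ ℕ) = fun _ => 1 := by ext; simp [monom]
  have hint := (h 0).1
  rw [hone, integrable_const_iff] at hint
  simpa using hint

theorem Represents.integrable_pow (h : Represents μ s) (j : Fin n) (k : ℕ) :
    Integrable (fun x : EuclideanSpace ℝ (Fin n) => x j ^ k) μ := by
  simpa only [← monom_single] using (h (Finsupp.single j k)).1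

theorem Represents.integral_pow (h : Represents μ s) (j : Fin n) (k : ℕ) :
    ∫ x, x j ^ k ∂μ = s (Finsupp.single j k) := by
  simpa only [← monom_single] using (h (Finsupp.single j k)).2

theorem Represents.momentGrowth_iff (h : Represents μ s) (hc : 0 ≤ c) :
    MomentGrowth c s ↔ ∀ᵐ x ∂μ, ∀ j, x j ∈ Set.Icc (-c) c := by
  have := h.isFiniteMeasure
  simp only [MomentGrowth, Set.mem_Icc, ← abs_le, ← h.integral_pow]
  rw [ae_all_iff]
  refine forall_congr' fun j => ⟨fun ⟨l, hl, ht⟩ => ?_, fun ha => ?_⟩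
  · exact ae_abs_le_of_tendsto_rpow_moment (fun k => h.integrable_pow j _) hc hl ht
  · exact exists_tendsto_rpow_moment (fun k => h.integrable_pow j _) hc ha

/-! ### Measures on cubes -/

theorem summable_prod_pow_div_factorial {r : Fin n → ℝ} (hr : ∀ j, 0 ≤ r j) :
    Summable fun α : Fin n →₀ ℕ => (∏ j, r j ^ α j) / ∏ j, ((α j).factorial : ℝ) := by
  have hpos (α : Fin n →₀ ℕ) : 0 ≤ ∏ j, r j ^ α j :=
    Finset.prod_nonneg fun j _ => pow_nonneg (hr j) _
  refine summable_of_summable_sum_multiIndices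
    (fun α => div_nonneg (hpos α) (by positivity)) ?_
  refine (Real.summable_pow_div_factorial (∑ j, r j)).congr fun k => ?_
  have hmult := sum_mul_pow_eq r (fun _ => 1) k
  simp only [mul_one, one_pow, Finset.prod_const_one] at hmult
  rw [hmult, Finset.sum_div]
  refine Finset.sum_congr rfl fun α _ => ?_
  field_simp

theorem norm_charTerm_le {α : Fin n →₀ ℕ} (h : |s α| ≤ c ^ α.degree) (z : Fin n → ℂ) :
    ‖charTerm s z α‖ ≤ (∏ j, (c * ‖z j‖) ^ α j) / ∏ j, ((α j).factorial : ℝ) := by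
  have hprod : ∏ j, (c * ‖z j‖) ^ α j = c ^ α.degree * ∏ j, ‖z j‖ ^ α j := by
    simp only [mul_pow, Finset.prod_mul_distrib, Finsupp.degree_eq_sum,
      Finset.prod_pow_eq_pow_sum]
  rw [norm_charTerm, hprod, mul_div_right_comm]
  gcongr

theorem isEntireSeries_of_abs_le (hc : 0 ≤ c) (h : ∀ α, |s α| ≤ c ^ α.degree) :
    IsEntireSeries s := fun z =>
  .of_norm_bounded (summable_prod_pow_div_factorial fun j => mul_nonneg hc (norm_nonneg (z j)))
    fun α => norm_charTerm_le (h α) z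

theorem hasSum_charTerm_monom (x : EuclideanSpace ℝ (Fin n)) (z : Fin n → ℂ) :
    HasSum (charTerm (fun α => monom α x) z) (Complex.exp (Complex.I * ∑ j, x j * z j)) := by
  have hentire : IsEntireSeries fun α => monom α x :=
    isEntireSeries_of_abs_le (norm_nonneg x) (abs_monom_le_pow (PiLp.norm_apply_le x))
  have hexp : HasSum (fun k : ℕ => (Complex.I * ∑ j, x j * z j) ^ k / (k.factorial : ℂ))
      (Complex.exp (Complex.I * ∑ j, x j * z j)) := by
    rw [Complex.exp_eq_exp_ℂ]
    exact NormedSpace.expSeries_div_hasSum_exp _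
  have hdegree (k : ℕ) : (Complex.I * ∑ j, x j * z j) ^ k / (k.factorial : ℂ) =
      ∑ α ∈ multiIndices n k, charTerm (fun α => monom α x) z α := by
    rw [mul_pow, sum_mul_pow_eq, Finset.mul_sum, Finset.sum_div]
    refine Finset.sum_congr rfl fun α hα => ?_
    have hk : (k.factorial : ℂ) ≠ 0 := Nat.cast_ne_zero.2 k.factorial_ne_zero
    rw [charTerm, monom, mem_multiIndices.1 hα]
    push_cast
    field_simp
  simp only [hdegree] at hexp
  rw [hexp.unique (hasSum_sum_multiIndices (hentire z).hasSum)]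
  exact (hentire z).hasSum

theorem charTerm_eq_mul_charTerm_one (s : (Fin n →₀ ℕ) → ℝ) (z : Fin n → ℂ) (α : Fin n →₀ ℕ) :
    charTerm s z α = s α * charTerm 1 z α := by
  simp only [charTerm, Pi.one_apply, Complex.ofReal_one]
  ring

theorem Represents.hasSum_charTerm (h : Represents μ s) (hc : 0 ≤ c)
    (hμ : ∀ᵐ x ∂μ, ∀ j, x j ∈ Set.Icc (-c) c) (z : Fin n → ℂ) :
    HasSum (charTerm s z) (∫ x, Complex.exp (Complex.I * ∑ j, x j * z j) ∂μ) := by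
  have := h.isFiniteMeasure
  have hterm (α : Fin n →₀ ℕ) : (fun x => charTerm (fun α => monom α x) z α) =
      fun x => (monom α x : ℂ) * charTerm 1 z α :=
    funext fun x => charTerm_eq_mul_charTerm_one _ z α
  have hval (α : Fin n →₀ ℕ) : charTerm s z α = ∫ x, charTerm (fun α => monom α x) z α ∂μ := by
    rw [hterm, integral_mul_const, integral_complex_ofReal, (h α).2,
      ← charTerm_eq_mul_charTerm_one]
  rw [funext hval]
  refine hasSum_integral_of_dominated_convergence
    (fun α _ => (∏ j, (c * ‖z j‖) ^ α j) / ∏ j, ((α j).factorial : ℝ)) (fun α => ?_) (fun α => ?_)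
    (ae_of_all _ fun _ => summable_prod_pow_div_factorial fun j => mul_nonneg hc (norm_nonneg _))
    (integrable_const _) (ae_of_all _ fun x => hasSum_charTerm_monom x z)
  · rw [hterm]
    exact ((h α).1.ofReal.mul_const _).1
  · filter_upwards [hμ] with x hx
    exact norm_charTerm_le (abs_monom_le_pow (fun j => abs_le.2 (hx j)) α) z

theorem Represents.isEntireSeries (h : Represents μ s) (hc : 0 ≤ c)
    (hμ : ∀ᵐ x ∂μ, ∀ j, x j ∈ Set.Icc (-c) c) : IsEntireSeries s :=
  fun z => (h.hasSum_charTerm hc hμ z).summable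

theorem Represents.charFun_eq (h : Represents μ s) (hc : 0 ≤ c)
    (hμ : ∀ᵐ x ∂μ, ∀ j, x j ∈ Set.Icc (-c) c) (z : EuclideanSpace ℝ (Fin n)) :
    charFun μ z = charSeries s z := by
  rw [charSeries, (h.hasSum_charTerm hc hμ _).tsum_eq, charFun_apply]
  refine integral_congr_ae (ae_of_all _ fun x => ?_)
  simp [PiLp.inner_apply, mul_comm]

-- Moment growth forces every representing measure onto the cube, where moments determine `charFun`.
theorem Represents.isDeterminate (h : Represents μ s) (hc : 0 ≤ c)
    (hμ : ∀ᵐ x ∂μ, ∀ j, x j ∈ Set.Icc (-c) c) : IsDeterminate s := by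
  refine ⟨μ, h, fun ν hν => ?_⟩
  have := h.isFiniteMeasure
  have := hν.isFiniteMeasure
  have hνc := (hν.momentGrowth_iff hc).1 ((h.momentGrowth_iff hc).2 hμ)
  refine Measure.ext_of_charFun (funext fun z => ?_)
  rw [hν.charFun_eq hc hνc, h.charFun_eq hc hμ]

end Represents

/-! ### Measures with square integrable density -/

section Density

variable {g g' : EuclideanSpace ℝ (Fin n) → ℂ} {s : (Fin n →₀ ℕ) → ℝ} {c : ℝ}

/-- The measure `dμ(x) = g(x) dx`. It is only meaningful when `g ≥ 0` almost everywhere: otherwise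
the imaginary part and the negative part of `g` are discarded. -/
abbrev densityMeasure (g : EuclideanSpace ℝ (Fin n) → ℂ) :
    Measure (EuclideanSpace ℝ (Fin n)) :=
  volume.withDensity fun x => ENNReal.ofReal (g x).re

theorem NonnegAE.congr (hnn : NonnegAE g) (h : g =ᵐ[volume] g') : NonnegAE g' := by
  filter_upwards [hnn, h] with x hx hgx
  rwa [← hgx]

theorem SuppInCube.congr (hsupp : SuppInCube c g) (h : g =ᵐ[volume] g') : SuppInCube c g' := by
  filter_upwards [hsupp, h] with x hx hgx
  rwa [← hgx]

theorem NonnegAE.ae_eq_ofReal_re (hnn : NonnegAE g) : ∀ᵐ x, g x = ((g x).re : ℂ) := by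
  filter_upwards [hnn] with x hx
  exact Complex.ext rfl hx.2

theorem integral_densityMeasure (hg : AEStronglyMeasurable g) (hnn : NonnegAE g)
    (φ : EuclideanSpace ℝ (Fin n) → ℂ) :
    ∫ x, φ x ∂densityMeasure g = ∫ x, φ x * g x := by
  have hre : AEMeasurable fun x => (g x).re :=
    (Complex.continuous_re.comp_aestronglyMeasurable hg).aemeasurable
  refine (integral_withDensity_eq_integral_smul₀ hre.real_toNNReal φ).trans
    (integral_congr_ae ?_)
  filter_upwards [hnn, hnn.ae_eq_ofReal_re] with x hx hx'
  rw [NNReal.smul_def, Real.coe_toNNReal _ hx.1, Complex.real_smul, ← hx', mul_comm]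

theorem charFun_densityMeasure (hg : AEStronglyMeasurable g) (hnn : NonnegAE g)
    (w : EuclideanSpace ℝ (Fin n)) :
    charFun (densityMeasure g) ((2 * Real.pi) • w) = 𝓕⁻ g w := by
  rw [charFun_apply, integral_densityMeasure hg hnn, Real.fourierInv_eq']
  simp only [inner_smul_right, smul_eq_mul]

theorem ae_densityMeasure_iff_suppInCube (hg : AEStronglyMeasurable g) (hnn : NonnegAE g)
    (c : ℝ) : (∀ᵐ x ∂densityMeasure g, ∀ j, x j ∈ Set.Icc (-c) c) ↔ SuppInCube c g := by
  have hre : AEMeasurable fun x => (g x).re :=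
    (Complex.continuous_re.comp_aestronglyMeasurable hg).aemeasurable
  rw [ae_withDensity_iff' hre.ennreal_ofReal, SuppInCube]
  refine eventually_congr ?_
  filter_upwards [hnn, hnn.ae_eq_ofReal_re] with x hx hx'
  have hne : ENNReal.ofReal (g x).re ≠ 0 ↔ g x ≠ 0 := by
    rw [Ne, ENNReal.ofReal_eq_zero, not_le, hx', Complex.ofReal_re, Complex.ofReal_ne_zero]
    exact hx.1.lt_iff_ne'
  rw [hne]
  exact not_imp_comm

theorem Represents.momentGrowth_iff_suppInCube (h : Represents (densityMeasure g) s)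
    (hg : AEStronglyMeasurable g) (hnn : NonnegAE g) (hc : 0 ≤ c) :
    MomentGrowth c s ↔ SuppInCube c g :=
  (h.momentGrowth_iff hc).trans (ae_densityMeasure_iff_suppInCube hg hnn c)

theorem Represents.charSeries_smul_eq_fourierInv (h : Represents (densityMeasure g) s)
    (hg : AEStronglyMeasurable g) (hnn : NonnegAE g) (hc : 0 ≤ c) (hsupp : SuppInCube c g)
    (w : EuclideanSpace ℝ (Fin n)) : charSeries s ((2 * Real.pi) • w) = 𝓕⁻ g w := by
  rw [← h.charFun_eq hc ((ae_densityMeasure_iff_suppInCube hg hnn c).2 hsupp),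
    charFun_densityMeasure hg hnn]

theorem represents_densityMeasure (hs : IsEntireSeries s) (hf : MemLp (charSeries s) 2)
    (hnn : NonnegAE (density (charSeries s) hf)) :
    Represents (densityMeasure (density (charSeries s) hf)) s := by
  have hd := isFourierL2_density hf
  have hcont : Continuous fun x => charSeries s ((2 * Real.pi) • x) :=
    (continuous_charSeries hs).comp (continuous_const_smul _)
  have hint := hd.integrable_of_nonneg hcont.continuousAt hnn
  have := isFiniteMeasure_withDensity_ofReal hint.re.hasFiniteIntegral
  refine represents_of_charFun_eq hs fun z => ?_
  have hinv := congrFun (hd.eq_fourierInv hcont hint) ((2 * Real.pi)⁻¹ • z)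
  rw [← charFun_densityMeasure hint.1 hnn, smul_inv_smul₀ Real.two_pi_pos.ne'] at hinv
  exact hinv.symm

theorem momentGrowth_iff_suppInCube_density (hs : IsEntireSeries s) (hf : MemLp (charSeries s) 2)
    (hnn : NonnegAE (density (charSeries s) hf)) (hc : 0 ≤ c) :
    MomentGrowth c s ↔ SuppInCube c (density (charSeries s) hf) :=
  (represents_densityMeasure hs hf hnn).momentGrowth_iff_suppInCube
    (isFourierL2_density hf).memLp_right.1 hnn hc

end Density

/-! ### Weak derivatives -/

theorem partialDeriv_rel {M : Type*} [CommMonoid M]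
    {R : (EuclideanSpace ℝ (Fin n) → ℂ) → M → Prop} {z : Fin n → M}
    (step : ∀ j ψ a, R ψ a → R (fun x => lineDeriv ℝ ψ x (EuclideanSpace.single j 1)) (z j * a))
    (β : Fin n →₀ ℕ) {φ : EuclideanSpace ℝ (Fin n) → ℂ} {a : M} (h : R φ a) :
    R (partialDeriv β φ) ((∏ j, z j ^ β j) * a) := by
  have hiter (j : Fin n) (k : ℕ) {ψ : EuclideanSpace ℝ (Fin n) → ℂ} {b : M} (hb : R ψ b) :
      R ((fun η x => lineDeriv ℝ η x (EuclideanSpace.single j 1))^[k] ψ) (z j ^ k * b) := by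
    induction k with
    | zero => simpa using hb
    | succ k ih =>
      rw [Function.iterate_succ_apply', pow_succ', mul_assoc]
      exact step j _ _ ih
  have hfold (l : List (Fin n)) :
      R (l.foldr (fun j ψ => (fun η x => lineDeriv ℝ η x (EuclideanSpace.single j 1))^[β j] ψ) φ)
        ((l.map fun j => z j ^ β j).prod * a) := by
    induction l with
    | nil => simpa using h
    | cons j l ih =>
      rw [List.foldr_cons, List.map_cons, List.prod_cons, mul_assoc]
      exact hiter j _ ih
  rw [← List.prod_ofFn, List.ofFn_eq_map]
  exact hfold _

theorem prod_I_mul_pow (β : Fin n →₀ ℕ) (w : EuclideanSpace ℝ (Fin n)) :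
    ∏ j, (Complex.I * (w j : ℂ)) ^ β j = Complex.I ^ β.degree * monom β w := by
  simp only [mul_pow, Finset.prod_mul_distrib, Finset.prod_pow_eq_pow_sum,
    ← Finsupp.degree_eq_sum, monom, Complex.ofReal_prod, Complex.ofReal_pow]

theorem fourier_lineDerivOp_single (S : SchwartzMap (EuclideanSpace ℝ (Fin n)) ℂ) (j : Fin n)
    (w : EuclideanSpace ℝ (Fin n)) :
    𝓕 (LineDeriv.lineDerivOp (EuclideanSpace.single j (1 : ℝ)) S :
        EuclideanSpace ℝ (Fin n) → ℂ) w =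
      Complex.I * ((2 * Real.pi) • w : EuclideanSpace ℝ (Fin n)) j *
        𝓕 (S : EuclideanSpace ℝ (Fin n) → ℂ) w := by
  have hgrowth : (fun x : EuclideanSpace ℝ (Fin n) =>
      inner ℝ x (EuclideanSpace.single j (1 : ℝ))).HasTemperateGrowth :=
    ((innerSL ℝ).flip _).hasTemperateGrowth
  have h := DFunLike.congr_fun
    (SchwartzMap.fourier_lineDerivOp_eq S (EuclideanSpace.single j (1 : ℝ))) w
  simp only [smul_apply, SchwartzMap.smulLeftCLM_apply_apply hgrowth,
    SchwartzMap.fourier_coe] at h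
  rw [h]
  simp [EuclideanSpace.inner_single_right]
  ring

theorem exists_schwartz_eq_partialDeriv (β : Fin n →₀ ℕ)
    (φ : SchwartzMap (EuclideanSpace ℝ (Fin n)) ℂ) :
    ∃ S : SchwartzMap (EuclideanSpace ℝ (Fin n)) ℂ, partialDeriv β φ = S ∧
      ∀ w, 𝓕 (S : EuclideanSpace ℝ (Fin n) → ℂ) w = Complex.I ^ β.degree *
        monom β ((2 * Real.pi) • w) * 𝓕 (φ : EuclideanSpace ℝ (Fin n) → ℂ) w := by
  have h := partialDeriv_rel
    (R := fun ψ (a : EuclideanSpace ℝ (Fin n) → ℂ) =>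
      ∃ S : SchwartzMap (EuclideanSpace ℝ (Fin n)) ℂ, ψ = S ∧
        𝓕 (S : EuclideanSpace ℝ (Fin n) → ℂ) = a)
    (z := fun j w => Complex.I * ((2 * Real.pi) • w : EuclideanSpace ℝ (Fin n)) j)
    (fun j ψ a ⟨S, hS, ha⟩ => ⟨LineDeriv.lineDerivOp (EuclideanSpace.single j (1 : ℝ)) S,
      by rw [hS]; exact funext fun x => (SchwartzMap.lineDerivOp_apply ..).symm,
      funext fun w => by rw [fourier_lineDerivOp_single, ha, Pi.mul_apply]⟩)
    β ⟨φ, rfl, rfl⟩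
  obtain ⟨S, hS, hF⟩ := h
  refine ⟨S, hS, fun w => ?_⟩
  rw [hF, ← prod_I_mul_pow]
  simp

/-- `h` is the weak derivative `∂ ^ β g`, tested against smooth functions with compact support. -/
def IsWeakDeriv (β : Fin n →₀ ℕ) (g h : EuclideanSpace ℝ (Fin n) → ℂ) : Prop :=
  ∀ φ : EuclideanSpace ℝ (Fin n) → ℂ, ContDiff ℝ ∞ φ → HasCompactSupport φ →
    ∫ x, g x * partialDeriv β φ x = (-1) ^ β.degree * ∫ x, h x * φ x

theorem IsFourierL2.isWeakDeriv {β : Fin n →₀ ℕ} {F g h : EuclideanSpace ℝ (Fin n) → ℂ}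
    (hg : IsFourierL2 F g)
    (hh : IsFourierL2 (fun w => (monom β ((2 * Real.pi) • w) : ℂ) * F w) h) :
    IsWeakDeriv β g fun x => (-Complex.I) ^ β.degree * h x := by
  intro φ hφ hc
  obtain ⟨S, hS, hF⟩ := exists_schwartz_eq_partialDeriv β (hc.toSchwartzMap hφ)
  have hφh : ∫ x, h x * φ x = _ := hh.integral_mul_schwartz (hc.toSchwartzMap hφ)
  have hS' : partialDeriv β φ = S := hS
  simp only [mul_assoc, integral_const_mul]
  rw [hS', hg.integral_mul_schwartz, hφh, ← mul_assoc, ← mul_pow, neg_one_mul, neg_neg,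
    ← integral_const_mul]
  refine integral_congr_ae (ae_of_all _ fun w => ?_)
  beta_reduce
  rw [hF]
  ring

theorem weakDerivMemL2_density {f : EuclideanSpace ℝ (Fin n) → ℂ} (hf : MemLp f 2)
    {β : Fin n →₀ ℕ} (hβ : MemLp (fun x => (monom β x : ℂ) * f x) 2) :
    WeakDerivMemL2 β (density f hf) :=
  ⟨_, (isFourierL2_density hβ).memLp_right.const_mul _,
    (isFourierL2_density hf).isWeakDeriv (isFourierL2_density hβ)⟩

/-! ### Weak derivatives with compact support -/

section Cube

/-- The character `x ↦ exp(2πi⟨x, w⟩)` of `ℝⁿ`. -/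
def planeWave (w x : EuclideanSpace ℝ (Fin n)) : ℂ :=
  Complex.exp ((2 * Real.pi * inner ℝ x w : ℝ) * Complex.I)

theorem contDiff_planeWave (w : EuclideanSpace ℝ (Fin n)) : ContDiff ℝ ∞ (planeWave w) := by
  have h : ContDiff ℝ ∞ fun x : EuclideanSpace ℝ (Fin n) => 2 * Real.pi * inner ℝ x w :=
    contDiff_const.mul (contDiff_id.inner ℝ contDiff_const)
  exact ((Complex.ofRealCLM.contDiff.comp h).mul contDiff_const).cexp

theorem fourierInv_eq_integral_mul_planeWave (u : EuclideanSpace ℝ (Fin n) → ℂ)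
    (w : EuclideanSpace ℝ (Fin n)) : 𝓕⁻ u w = ∫ x, u x * planeWave w x := by
  simp only [Real.fourierInv_eq', smul_eq_mul, planeWave, mul_comm]

theorem hasLineDerivAt_planeWave (w x : EuclideanSpace ℝ (Fin n)) (j : Fin n) :
    HasLineDerivAt ℝ (planeWave w)
      (Complex.I * ((2 * Real.pi) • w : EuclideanSpace ℝ (Fin n)) j * planeWave w x) x
      (EuclideanSpace.single j 1) := by
  have hphase : HasDerivAt (fun t : ℝ => 2 * Real.pi *
      inner ℝ (x + t • EuclideanSpace.single j (1 : ℝ)) w) (2 * Real.pi * w j) 0 := by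
    have haffine : (fun t : ℝ => 2 * Real.pi *
        inner ℝ (x + t • EuclideanSpace.single j (1 : ℝ)) w) =
        fun t : ℝ => 2 * Real.pi * inner ℝ x w + t * (2 * Real.pi * w j) := by
      ext t
      rw [inner_add_left, inner_smul_left, EuclideanSpace.inner_single_left]
      simp
      ring
    rw [haffine]
    exact (hasDerivAt_mul_const _).const_add _
  refine (hphase.ofReal_comp.mul_const Complex.I).cexp.congr_deriv ?_
  simp [planeWave]
  ring

theorem eqOn_partialDeriv_planeWave {φ : EuclideanSpace ℝ (Fin n) → ℂ}
    {U : Set (EuclideanSpace ℝ (Fin n))} (hU : IsOpen U) {a : ℂ} {w : EuclideanSpace ℝ (Fin n)}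
    (h : Set.EqOn φ (fun x => a * planeWave w x) U) (β : Fin n →₀ ℕ) :
    Set.EqOn (partialDeriv β φ)
      (fun x => Complex.I ^ β.degree * monom β ((2 * Real.pi) • w) * a * planeWave w x) U := by
  rw [← prod_I_mul_pow]
  refine partialDeriv_rel (R := fun ψ b => Set.EqOn ψ (fun x => b * planeWave w x) U)
    (fun j ψ b hψ x hx => ?_) β h
  have hderiv : HasLineDerivAt ℝ (fun x => b * planeWave w x) _ x (EuclideanSpace.single j 1) :=
    HasDerivAt.const_mul b (hasLineDerivAt_planeWave w x j)
  beta_reduce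
  rw [(hψ.eventuallyEq_of_mem (hU.mem_nhds hx)).lineDeriv_eq, hderiv.lineDeriv]
  ring

variable {c : ℝ} {g h : EuclideanSpace ℝ (Fin n) → ℂ} {β : Fin n →₀ ℕ}

/-- The cube `[-c, c]ⁿ`. -/
def cube (n : ℕ) (c : ℝ) : Set (EuclideanSpace ℝ (Fin n)) := {x | ∀ j, x j ∈ Set.Icc (-c) c}

theorem isClosed_cube (c : ℝ) : IsClosed (cube n c) := by
  simp only [cube, Set.ofPred_forall]
  exact isClosed_iInter fun j => isClosed_Icc.preimage (by fun_prop)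

theorem isBounded_cube (c : ℝ) : Bornology.IsBounded (cube n c) := by
  refine isBounded_iff_forall_norm_le.2 ⟨√(n * c ^ 2), fun x hx => ?_⟩
  rw [EuclideanSpace.norm_eq]
  refine Real.sqrt_le_sqrt ?_
  calc ∑ j, ‖x j‖ ^ 2 ≤ ∑ _j : Fin n, c ^ 2 :=
        Finset.sum_le_sum fun j _ => pow_le_pow_left₀ (norm_nonneg _) (abs_le.2 (hx j)) 2
    _ = n * c ^ 2 := by simp

theorem SuppInCube.integrable (h : SuppInCube c g) (hg : MemLp g 2) : Integrable g := by
  have : IsFiniteMeasure (volume.restrict (cube n c)) :=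
    ⟨by rw [Measure.restrict_apply_univ]; exact (isBounded_cube c).measure_lt_top⟩
  have hon : IntegrableOn g (cube n c) := (hg.restrict (cube n c)).integrable one_le_two
  exact hon.integrable_of_ae_notMem_eq_zero h

theorem SuppInCube.integral_mul_eq_of_eqOn {φ ψ : EuclideanSpace ℝ (Fin n) → ℂ}
    (hg : SuppInCube c g) (h : Set.EqOn φ ψ (cube n c)) :
    ∫ x, g x * φ x = ∫ x, g x * ψ x := by
  refine integral_congr_ae ?_
  filter_upwards [hg] with x hx
  by_cases hxc : x ∈ cube n c
  · rw [h hxc]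
  · rw [hx hxc, zero_mul, zero_mul]

theorem SuppInCube.of_isWeakDeriv (hg : SuppInCube c g) (hh : LocallyIntegrable h)
    (hβ : IsWeakDeriv β g h) : SuppInCube c h := by
  refine (isClosed_cube (n := n) c).isOpen_compl.ae_eq_zero_of_integral_contDiff_smul_eq_zero
    (hh.locallyIntegrableOn _) fun χ hχ hc hsupp => ?_
  have hχ0 : Set.EqOn (Complex.ofRealCLM ∘ χ) (fun x => 0 * planeWave 0 x) (tsupport χ)ᶜ :=
    fun x hx => by simp [image_eq_zero_of_notMem_tsupport hx]
  have hzero : Set.EqOn (partialDeriv β (Complex.ofRealCLM ∘ χ)) (fun _ => 0) (cube n c) :=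
    fun x hx => by
      simpa using eqOn_partialDeriv_planeWave (isClosed_tsupport χ).isOpen_compl hχ0 β
        fun hx' => hsupp hx' hx
  have htest := hβ (Complex.ofRealCLM ∘ χ) (by fun_prop) (hc.comp_left rfl)
  rw [hg.integral_mul_eq_of_eqOn hzero] at htest
  simpa [mul_comm] using htest

-- On the cube, a smoothly truncated character is an admissible test function.
theorem IsWeakDeriv.fourierInv_eq (hβ : IsWeakDeriv β g h) (hg : SuppInCube c g)
    (hh : SuppInCube c h) (w : EuclideanSpace ℝ (Fin n)) :
    𝓕⁻ h w = (-Complex.I) ^ β.degree * (monom β ((2 * Real.pi) • w) * 𝓕⁻ g w) := by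
  obtain ⟨r, hr, hcube⟩ := (isBounded_cube (n := n) c).subset_ball_lt 0 0
  let χ : ContDiffBump (0 : EuclideanSpace ℝ (Fin n)) := ⟨r, r + 1, hr, lt_add_one r⟩
  set φ : EuclideanSpace ℝ (Fin n) → ℂ := fun x => χ x * planeWave w x
  have hφ : Set.EqOn φ (fun x => 1 * planeWave w x) (Metric.ball 0 r) := fun x hx => by
    simp only [φ]
    rw [χ.one_of_mem_closedBall (Metric.ball_subset_closedBall hx), Complex.ofReal_one]
  have htest := hβ φ ((Complex.ofRealCLM.contDiff.comp χ.contDiff).mul (contDiff_planeWave w))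
    ((χ.hasCompactSupport.comp_left (g := fun r : ℝ => (r : ℂ)) Complex.ofReal_zero).mul_right)
  rw [hg.integral_mul_eq_of_eqOn
      ((eqOn_partialDeriv_planeWave Metric.isOpen_ball hφ β).mono hcube),
    hh.integral_mul_eq_of_eqOn (hφ.mono hcube)] at htest
  simp only [one_mul, mul_one, mul_left_comm (g _), integral_const_mul,
    ← fourierInv_eq_integral_mul_planeWave] at htest
  rw [neg_pow, mul_assoc, ← mul_assoc (Complex.I ^ _), htest, ← mul_assoc, ← mul_pow,
    neg_one_mul, neg_neg, one_pow, one_mul]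

theorem memLp_monom_mul_of_weakDeriv {f : EuclideanSpace ℝ (Fin n) → ℂ}
    (hfg : ∀ w, f ((2 * Real.pi) • w) = 𝓕⁻ g w) (hg : SuppInCube c g)
    (hβ : WeakDerivMemL2 β g) : MemLp (fun x => (monom β x : ℂ) * f x) 2 := by
  obtain ⟨h, hh, hweak : IsWeakDeriv β g h⟩ := hβ
  have hhc := hg.of_isWeakDeriv (hh.locallyIntegrable one_le_two) hweak
  have hinv : MemLp (𝓕⁻ h) 2 := (IsFourierL2.fourierInv (hhc.integrable hh) hh).memLp_left
  have hscaled := memLp_comp_smul hinv (inv_ne_zero Real.two_pi_pos.ne')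
  convert hscaled.const_mul (Complex.I ^ β.degree) using 2 with x
  rw [hweak.fourierInv_eq hg hhc, ← hfg, smul_inv_smul₀ Real.two_pi_pos.ne', ← mul_assoc,
    ← mul_pow, mul_neg, Complex.I_mul_I, neg_neg, one_pow, one_mul]

end Cube

section Equivalence

variable {s : (Fin n →₀ ℕ) → ℝ} {c : ℝ} {g : EuclideanSpace ℝ (Fin n) → ℂ}

theorem forall_isEntireSeries_momentDeriv_iff {d : ℕ} :
    (∀ β : Fin n →₀ ℕ, β.degree ≤ d → IsEntireSeries (momentDeriv β s)) ↔ IsEntireSeries s :=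
  ⟨fun h => by simpa only [momentDeriv_zero] using h 0 (by simp), fun h β _ => h.momentDeriv β⟩

theorem isDeterminate_of_suppInCube_density (hs : IsEntireSeries s) (hf : MemLp (charSeries s) 2)
    (hnn : NonnegAE (density (charSeries s) hf)) (hc : 0 ≤ c)
    (hsupp : SuppInCube c (density (charSeries s) hf)) : IsDeterminate s :=
  (represents_densityMeasure hs hf hnn).isDeterminate hc
    ((ae_densityMeasure_iff_suppInCube (isFourierL2_density hf).memLp_right.1 hnn c).2 hsupp)

theorem Represents.isEntireSeries_of_suppInCube (h : Represents (densityMeasure g) s)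
    (hg : AEStronglyMeasurable g) (hnn : NonnegAE g) (hc : 0 ≤ c) (hsupp : SuppInCube c g) :
    IsEntireSeries s :=
  h.isEntireSeries hc ((ae_densityMeasure_iff_suppInCube hg hnn c).2 hsupp)

theorem Represents.exists_density_ae_eq (h : Represents (densityMeasure g) s) (hg : MemLp g 2)
    (hnn : NonnegAE g) (hc : 0 ≤ c) (hsupp : SuppInCube c g) :
    ∃ hf : MemLp (charSeries s) 2, density (charSeries s) hf =ᵐ[volume] g := by
  have hF : IsFourierL2 (fun w => charSeries s ((2 * Real.pi) • w)) g := by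
    rw [funext (h.charSeries_smul_eq_fourierInv hg.1 hnn hc hsupp)]
    exact .fourierInv (hsupp.integrable hg) hg
  have hf : MemLp (charSeries s) 2 := by
    simpa only [smul_inv_smul₀ Real.two_pi_pos.ne'] using
      memLp_comp_smul hF.memLp_left (inv_ne_zero Real.two_pi_pos.ne')
  exact ⟨hf, (isFourierL2_density hf).right_unique hF⟩

end Equivalence

end MomentDensity

end

theorem mainTheorem11 (n : ℕ) (hn : 1 ≤ n) (d : ℕ) (s : (Fin n →₀ ℕ) → ℝ) :
    List.TFAE [
      -- (i)
      MomentDensity.IsEntireSeries s ∧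
        (∀ β : Fin n →₀ ℕ, β.degree ≤ d →
          MemLp (fun x => (MomentDensity.monom β x : ℂ) * MomentDensity.charSeries s x) 2 volume) ∧
        ∃ hf : MemLp (MomentDensity.charSeries s) 2 volume,
          MomentDensity.NonnegAE (MomentDensity.density (MomentDensity.charSeries s) hf) ∧
          ∃ c : ℝ, 0 ≤ c ∧
            MomentDensity.SuppInCube c (MomentDensity.density (MomentDensity.charSeries s) hf),
      -- (ii)
      MomentDensity.IsEntireSeries s ∧
        (∀ β : Fin n →₀ ℕ, β.degree ≤ d →
          MemLp (fun x => (MomentDensity.monom β x : ℂ) * MomentDensity.charSeries s x) 2 volume) ∧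
        (∃ hf : MemLp (MomentDensity.charSeries s) 2 volume,
          MomentDensity.NonnegAE (MomentDensity.density (MomentDensity.charSeries s) hf)) ∧
        ∃ c : ℝ, 0 ≤ c ∧ MomentDensity.MomentGrowth c s,
      -- (iii)
      (∀ β : Fin n →₀ ℕ, β.degree ≤ d →
          MomentDensity.IsEntireSeries (MomentDensity.momentDeriv β s)) ∧
        (∀ β : Fin n →₀ ℕ, β.degree ≤ d →
          MemLp (MomentDensity.charSeries (MomentDensity.momentDeriv β s)) 2 volume) ∧
        ∃ hf : MemLp (MomentDensity.charSeries (MomentDensity.momentDeriv 0 s)) 2 volume,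
          MomentDensity.NonnegAE (MomentDensity.density
            (MomentDensity.charSeries (MomentDensity.momentDeriv 0 s)) hf) ∧
          ∃ c : ℝ, 0 ≤ c ∧ MomentDensity.SuppInCube c (MomentDensity.density
            (MomentDensity.charSeries (MomentDensity.momentDeriv 0 s)) hf),
      -- (iv)
      (∀ β : Fin n →₀ ℕ, β.degree ≤ d →
          MomentDensity.IsEntireSeries (MomentDensity.momentDeriv β s)) ∧
        (∀ β : Fin n →₀ ℕ, β.degree ≤ d →
          MemLp (MomentDensity.charSeries (MomentDensity.momentDeriv β s)) 2 volume) ∧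
        (∃ hf : MemLp (MomentDensity.charSeries (MomentDensity.momentDeriv 0 s)) 2 volume,
          MomentDensity.NonnegAE (MomentDensity.density
            (MomentDensity.charSeries (MomentDensity.momentDeriv 0 s)) hf)) ∧
        ∃ c : ℝ, 0 ≤ c ∧ MomentDensity.MomentGrowth c s,
      -- (v)
      MomentDensity.IsDeterminate s ∧
        ∃ g : EuclideanSpace ℝ (Fin n) → ℂ,
          MemLp g 2 volume ∧
          MomentDensity.Represents (volume.withDensity fun x => ENNReal.ofReal (g x).re) s ∧
          (∀ β : Fin n →₀ ℕ, β.degree ≤ d → MomentDensity.WeakDerivMemL2 β g) ∧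
          MomentDensity.NonnegAE g ∧
          ∃ c : ℝ, 0 ≤ c ∧ MomentDensity.SuppInCube c g] := by
  rw [MomentDensity.momentDeriv_zero, MomentDensity.forall_isEntireSeries_momentDeriv_iff]
  tfae_have 1 ↔ 3 := and_congr_right fun hs => and_congr_left' <| forall₂_congr fun β _ =>
    (MomentDensity.memLp_charSeries_momentDeriv_iff hs β).symm
  tfae_have 2 ↔ 4 := and_congr_right fun hs => and_congr_left' <| forall₂_congr fun β _ =>
    (MomentDensity.memLp_charSeries_momentDeriv_iff hs β).symm
  tfae_have 1 ↔ 2 := and_congr_right fun hs => and_congr_right fun _ => by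
    rw [← exists_and_right]
    exact exists_congr fun hf => and_congr_right fun hnn => exists_congr fun c =>
      and_congr_right fun hc =>
        (MomentDensity.momentGrowth_iff_suppInCube_density hs hf hnn hc).symm
  tfae_have 1 → 5 := fun ⟨hs, hmonom, hf, hnn, c, hc, hsupp⟩ =>
    ⟨MomentDensity.isDeterminate_of_suppInCube_density hs hf hnn hc hsupp, _,
      (MomentDensity.isFourierL2_density hf).memLp_right,
      MomentDensity.represents_densityMeasure hs hf hnn,
      fun β hβ => MomentDensity.weakDerivMemL2_density hf (hmonom β hβ), hnn, c, hc, hsupp⟩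
  tfae_have 5 → 1 := by
    rintro ⟨-, g, hg, hrep, hweak, hnn, c, hc, hsupp⟩
    have hfg := hrep.charSeries_smul_eq_fourierInv hg.1 hnn hc hsupp
    obtain ⟨hf, hdensity⟩ := hrep.exists_density_ae_eq hg hnn hc hsupp
    exact ⟨hrep.isEntireSeries_of_suppInCube hg.1 hnn hc hsupp,
      fun β hβ => MomentDensity.memLp_monom_mul_of_weakDeriv hfg hsupp (hweak β hβ), hf,
      hnn.congr hdensity.symm, c, hc, hsupp.congr hdensity.symm⟩
  tfae_finish
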